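/- Let $p$ be a prime and let $e>2$ be an integer such that $e\mid p^t+1$ for some positive integer $t$; let $j$ be the smallest such $t$. Let $s\ge 1$ and $m\ge 1$ be integers and put $q=p^{2js}$. Then $e$ divides $q-1$; put $r=q^{m-1}(q-1)/e$ and $V=\mathbb F_q^{2m}$. (For $D\subseteq V$ with $0\notin D=-D$, the Cayley graph $\mathrm{Cay}(V,D)$ has vertex set $V$, and $x,y$ are adjacent if and only if $x-y\in D$.) (1) For each $\varepsilon\in\{1,-1\}$ there is a subset $D\subseteq V$ with $0\notin D=-D$ such that $\mathrm{Cay}(V,D)$ is strongly regular with parameters $$\bigl(q^{2m},\; r(q^m-\varepsilon),\; \varepsilon q^m+r^2-3\varepsilon r,\; r^2-\varepsilon r\bigr).\qquad(*)$$ (2) (The construction of Feng et al. with quadratic forms.) Let $Q:V\to\mathbb F_q$ be any nonsingular quadratic form, that is, with $B(x,y)=Q(x+y)-Q(x)-Q(y)$, the only $w\in V$ with $Q(w)=0$ and $B(v,w)=0$ for all $v\in V$ is $w=0$. Then there is a sign $\varepsilon\in\{1,-1\}$ such that for every primitive element $\gamma$ of $\mathbb F_q$ and every $0\le i\le e-1$,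 with $C_i=\gamma^i\langle\gamma^e\rangle$, the set $D=\{x\in V: Q(x)\in C_i\}$ satisfies $0\notin D=-D$ and $\mathrm{Cay}(V,D)$ is strongly regular with the parameters $(*)$. Moreover $\varepsilon=1$ if $Q$ is hyperbolic, i.e. equivalent under an invertible linear change of variables to $x_1x_2+x_3x_4+\cdots+x_{2m-1}x_{2m}$, and $\varepsilon=-1$ if $Q$ is elliptic, i.e. equivalent to $x_1x_2+\cdots+x_{2m-3}x_{2m-2}+(ax_{2m-1}^2+bx_{2m-1}x_{2m}+cx_{2m}^2)$ with $aX^2+bXY+cY^2$ irreducible over $\mathbb F_q$. -/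

import Mathlib

/-- The cyclotomic class `C_i^{(e,q)} = γ ^ i ⟨γ ^ e⟩` of the field `F`, as a set of elements of `F`. -/
def cyclotomicClass {F : Type*} [Field F] (γ : Fˣ) (e i : ℕ) : Set F :=
  {x : F | ∃ y ∈ Subgroup.zpowers (γ ^ e), x = ((γ ^ i * y : Fˣ) : F)}

/-- `Q` is equivalent, under an invertible linear change of variables, to
`x₁x₂ + x₃x₄ + ⋯ + x_{2m-1}x_{2m}` (coordinates are numbered from `0` in the code). -/
def IsHyperbolicForm {F : Type*} [Field F] {m : ℕ}
    (Q : QuadraticForm F (Fin (2 * m) → F)) : Prop :=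
  ∃ L : (Fin (2 * m) → F) ≃ₗ[F] (Fin (2 * m) → F), ∀ x : Fin (2 * m) → F,
    Q (L x) = ∑ i : Fin m, x ⟨2 * i, by omega⟩ * x ⟨2 * i + 1, by omega⟩

open MvPolynomial in
/-- `Q` is equivalent, under an invertible linear change of variables, to
`x₁x₂ + ⋯ + x_{2m-3}x_{2m-2} + (a x_{2m-1}² + b x_{2m-1}x_{2m} + c x_{2m}²)`
with `a X² + b X Y + c Y²` irreducible over `F` (for `m ≥ 1`). -/
def IsEllipticForm {F : Type*} [Field F] {m : ℕ}
    (Q : QuadraticForm F (Fin (2 * m) → F)) : Prop :=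
  ∃ a b c : F,
    Irreducible (C a * X 0 ^ 2 + C b * (X 0 * X 1) + C c * X 1 ^ 2 : MvPolynomial (Fin 2) F) ∧
    ∃ L : (Fin (2 * m) → F) ≃ₗ[F] (Fin (2 * m) → F), ∀ x : Fin (2 * m) → F,
      Q (L x) = ∑ i : Fin m,
        (let y := x ⟨2 * i, by omega⟩
         let z := x ⟨2 * i + 1, by omega⟩
         if (i : ℕ) + 1 < m then y * z else a * y ^ 2 + b * (y * z) + c * z ^ 2)

open Classical in
/-- `D` is a connection set (`0 ∉ D` and `-D = D`) in the finite abelian group `G`, and the Cayley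
graph `Cay(G, D)` is strongly regular with parameters `(v, k, l, μ)`. The parameters are given as
integers, since the formulas for them contain signs. -/
def IsSRCayley {G : Type*} [AddCommGroup G] [Fintype G] (D : Set G) (v k l μ : ℤ) : Prop :=
  (0 : G) ∉ D ∧ (∀ x : G, -x ∈ D ↔ x ∈ D) ∧
    ∃ v' k' l' μ' : ℕ, (v' : ℤ) = v ∧ (k' : ℤ) = k ∧ (l' : ℤ) = l ∧ (μ' : ℤ) = μ ∧
      (SimpleGraph.addCayley D).IsSRGWith v' k' l' μ'

/-- `Cay(G, D)` is strongly regular with parameters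
`(n², r(n - ε), εn + r² - 3εr, r² - εr)`: Latin square type for `ε = 1`, negative Latin square type
for `ε = -1`. -/
def IsLatinTypeCayley {G : Type*} [AddCommGroup G] [Fintype G] (D : Set G) (ε n r : ℤ) : Prop :=
  IsSRCayley D (n ^ 2) (r * (n - ε)) (ε * n + r ^ 2 - 3 * ε * r) (r ^ 2 - ε * r)

/-! Let `H` be the group of `e`-th powers in `Fˣ`. Everything rests on a duality: the Fourier
transform of the indicator of `{x | Q x ∈ cH}`, taken with the pairing `ψ (polar Q b x)`, is up to a
constant and a correction at `b = 0` a multiple of the indicator of another such set, with coset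
`k²c⁻¹H` (`cosetSum_eq`). The square of the transform then has the same shape, and transforming back
returns to `cH` because `c ↦ k²c⁻¹` is an involution. So the number of ways to write `z ≠ 0` as a
sum of two elements of `D` depends only on whether `z ∈ D`
(`isLatinTypeCayley_of_twoValuedPeriods`).

The duality has two inputs. First, the Gauss sum of `aQ` must be the same number `±q^m` for all `a ≠
0` (`exists_sum_addChar_eq`); its sign is `ε`, evaluated directly for hyperbolic and elliptic forms.
Second, the periods of `H` must take one value on a single coset `kH` and another elsewhere
(`TwoValuedPeriods`), with `n² = q`. If `q = |K|²` and `e ∣ |K| + 1`, then `H` contains `Kˣ` and the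
periods are counted directly. The general case climbs a tower of quadratic extensions: a period
upstairs is a coset sum for the norm form, so the duality itself carries the property from `K` to
`F` (`TwoValuedPeriods.comp_trace`). -/

set_option linter.unusedSectionVars false

section CharacterSums

open scoped Classical

/-! ### Periods of subgroups and sums of Kloosterman sums -/

/-- The periods of the subgroup `H` of `Fˣ` with respect to `ψ` take two values: one on the
coset `kH`, the other on the remaining cosets. -/
def TwoValuedPeriods {F : Type*} [Field F] [Fintype F] (ψ : AddChar F ℂ) (H : Subgroup Fˣ)
    (e : ℕ) (n : ℤ) (k : Fˣ) : Prop :=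
  ∀ c : Fˣ, (e : ℂ) * ∑ h : H, ψ ((c * h : Fˣ) : F) =
    -1 - n + if c * k⁻¹ ∈ H then (e : ℂ) * n else 0

/-- The field element `t` lies in the coset `cH`. -/
def InCoset {F : Type*} [Field F] (H : Subgroup Fˣ) (c : Fˣ) (t : F) : Prop :=
  ∃ h ∈ H, t = ((c * h : Fˣ) : F)

theorem inCoset_coe {F : Type*} [Field F] {H : Subgroup Fˣ} {c t : Fˣ} :
    InCoset H c (t : F) ↔ c⁻¹ * t ∈ H := by
  constructor
  · rintro ⟨h, hh, e⟩
    rw [Units.ext e]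
    simpa using hh
  · intro h
    exact ⟨_, h, by simp⟩

theorem not_inCoset_zero {F : Type*} [Field F] {H : Subgroup Fˣ} {c : Fˣ} :
    ¬ InCoset H c (0 : F) := by
  rintro ⟨h, -, e⟩
  exact (c * h).ne_zero e.symm

theorem sum_ite_mem_subgroup {G : Type*} [CommGroup G] [Fintype G] (H : Subgroup G) (g : G)
    (f : G → ℂ) : ∑ a : G, (if g * a ∈ H then f a else 0) = ∑ h : H, f (g⁻¹ * h) := by
  rw [← Finset.sum_filter]
  refine Finset.sum_bij' (fun a ha ↦ ⟨g * a, (Finset.mem_filter.1 ha).2⟩)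
    (fun h _ ↦ g⁻¹ * h) ?_ ?_ ?_ ?_ ?_ <;> simp

theorem sum_ite_inCoset {F : Type*} [Field F] [Fintype F] (H : Subgroup Fˣ) (c : Fˣ) (t : F)
    (z : ℂ) : (if InCoset H c t then z else 0) =
      ∑ h : H, if t = ((c * h : Fˣ) : F) then z else 0 := by
  split_ifs with h
  · obtain ⟨h, hh, rfl⟩ := h
    rw [Finset.sum_eq_single (⟨h, hh⟩ : H)]
    · simp
    · intro b _ hb
      rw [if_neg]
      intro e
      exact hb (Subtype.ext (mul_left_cancel (Units.ext e)).symm)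
    · simp
  · exact (Finset.sum_eq_zero fun (x : H) _ ↦ if_neg fun e ↦ h ⟨x, x.2, e⟩).symm

theorem sum_eq_zero_add_sum_units {F : Type*} [Field F] [Fintype F] (f : F → ℂ) :
    ∑ a : F, f a = f 0 + ∑ a : Fˣ, f a := by
  classical
  rw [← Finset.add_sum_erase _ _ (Finset.mem_univ (0 : F))]
  congr 1
  refine Finset.sum_bij' (fun a ha ↦ Units.mk0 a (Finset.ne_of_mem_erase ha))
    (fun a _ ↦ (a : F)) ?_ ?_ ?_ ?_ ?_ <;> simp

theorem sum_addChar_mul {F : Type*} [Field F] [Fintype F] {ψ : AddChar F ℂ} (hψ : ψ ≠ 1)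
 (b : F) : ∑ a : F, ψ (a * b) = if b = 0 then (Fintype.card F : ℂ) else 0 := by
  have := AddChar.sum_mulShift (R' := ℂ) b (AddChar.IsPrimitive.of_ne_one hψ)
  simpa using this

theorem sum_units_addChar {F : Type*} [Field F] [Fintype F] {ψ : AddChar F ℂ} (hψ : ψ ≠ 1)
    (b : Fˣ) : ∑ a : Fˣ, ψ (a * b) = -1 := by
  classical
  have h1 := sum_addChar_mul hψ (b : F)
  rw [sum_eq_zero_add_sum_units] at h1
  simp only [zero_mul, AddChar.map_zero_eq_one, Units.ne_zero, if_false] at h1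
  linear_combination h1

theorem sum_units_addChar_inv {F : Type*} [Field F] [Fintype F] {ψ : AddChar F ℂ} (hψ : ψ ≠ 1)
    (b : Fˣ) : ∑ a : Fˣ, ψ (b * (a⁻¹ : Fˣ)) = -1 := by
  rw [← sum_units_addChar hψ b, ← Equiv.sum_comp (Equiv.inv Fˣ)]
  simp [mul_comm]

/-- After exchanging the sums, the inner sum over `H` is a period. Its constant part meets a
complete sum equal to `-1`; its exceptional part confines `a` to one coset, which produces a second
period, at `t c k⁻¹`. -/
theorem TwoValuedPeriods.sum_kloosterman {F : Type*} [Field F] [Fintype F] {ψ : AddChar F ℂ}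
    (hψ : ψ ≠ 1) {H : Subgroup Fˣ} {e : ℕ} {n : ℤ} {k : Fˣ} (h : TwoValuedPeriods ψ H e n k)
    (hn : (n : ℂ) ^ 2 = Fintype.card F) (c t : Fˣ) :
    (e : ℂ) * ∑ x : H, ∑ a : Fˣ, ψ (a * (c * x : Fˣ) + t * (a⁻¹ : Fˣ)) =
      1 - Fintype.card F + if (k ^ 2 * c⁻¹)⁻¹ * t ∈ H then (e : ℂ) * Fintype.card F else 0 := by
  have h1 : (e : ℂ) * ∑ x : H, ∑ a : Fˣ, ψ (a * (c * x : Fˣ) + t * (a⁻¹ : Fˣ)) =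
      ∑ a : Fˣ, ψ (t * (a⁻¹ : Fˣ)) * ((e : ℂ) * ∑ x : H, ψ ((a * c * x : Fˣ) : F)) := by
    rw [Finset.sum_comm, Finset.mul_sum]
    refine Finset.sum_congr rfl fun a _ ↦ ?_
    rw [mul_left_comm]
    congr 1
    rw [Finset.mul_sum]
    refine Finset.sum_congr rfl fun x _ ↦ ?_
    rw [AddChar.map_add_eq_mul, mul_comm]
    simp [mul_assoc]
  have h2 : ∀ a : Fˣ, ψ (t * (a⁻¹ : Fˣ)) * ((e : ℂ) * ∑ x : H, ψ ((a * c * x : Fˣ) : F)) =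
      ψ (t * (a⁻¹ : Fˣ)) * (-1 - n) +
        e * n * if (c * k⁻¹) * a ∈ H then ψ (t * (a⁻¹ : Fˣ)) else 0 := by
    intro a
    rw [h (a * c), show a * c * k⁻¹ = (c * k⁻¹) * a by rw [mul_assoc, mul_comm]]
    split_ifs <;> ring
  rw [h1, Finset.sum_congr rfl fun a _ ↦ h2 a, Finset.sum_add_distrib, ← Finset.sum_mul,
    sum_units_addChar_inv hψ, ← Finset.mul_sum,
    sum_ite_mem_subgroup H (c * k⁻¹) fun a ↦ ψ (t * (a⁻¹ : Fˣ))]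
  have h3 : ∑ x : H, ψ (t * (((c * k⁻¹)⁻¹ * x)⁻¹ : Fˣ)) =
      ∑ x : H, ψ ((t * c * k⁻¹ * x : Fˣ) : F) := by
    rw [← Equiv.sum_comp (Equiv.inv H)]
    refine Finset.sum_congr rfl fun x _ ↦ ?_
    congr 1
    simp only [Equiv.inv_apply, InvMemClass.coe_inv]
    rw [← Units.val_mul]
    congr 1
    simp only [mul_inv, inv_inv, mul_assoc]
  have h4 := h (t * c * k⁻¹)
  rw [h3, mul_assoc (e : ℂ), mul_left_comm, h4,
    show (k ^ 2 * c⁻¹)⁻¹ * t = t * c * k⁻¹ * k⁻¹ by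
      rw [mul_inv, inv_inv, sq, mul_inv, mul_comm _ t, mul_comm _ c]; simp only [mul_assoc]]
  split_ifs <;> rw [← hn] <;> ring

/-! ### Fourier transform of the set where `Q` lies in a coset -/

section QuadraticCharacterSums

variable {F V : Type*} [Field F] [Fintype F] [AddCommGroup V] [Module F V] [Fintype V]

theorem sum_addChar_bilin {ψ : AddChar F ℂ} (hψ : ψ ≠ 1) (f : V →ₗ[F] F) :
    ∑ x, ψ (f x) = if f = 0 then (Fintype.card V : ℂ) else 0 := by
  have h := AddChar.sum_eq_ite (ψ.compAddMonoidHom f.toAddMonoidHom)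
  simp only [AddChar.compAddMonoidHom_apply, LinearMap.toAddMonoidHom_coe] at h
  rw [h]
  congr 1
  refine propext ⟨fun h0 ↦ ?_, fun h0 ↦ ?_⟩
  · by_contra hf
    obtain ⟨x, hx⟩ : ∃ x, f x ≠ 0 := by
      by_contra! h1
      exact hf (LinearMap.ext h1)
    apply hψ
    ext a
    have := DFunLike.congr_fun h0 ((a / f x) • x)
    simpa [hx] using this
  · ext x
    simp [h0]

theorem sum_addChar_polar {ψ : AddChar F ℂ} (hψ : ψ ≠ 1) {Q : QuadraticForm F V}
    (hB : ∀ b, (∀ x, QuadraticMap.polar Q b x = 0) → b = 0) (b : V) :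
    ∑ x, ψ (QuadraticMap.polar Q b x) = if b = 0 then (Fintype.card V : ℂ) else 0 := by
  have h := sum_addChar_bilin hψ (QuadraticMap.polarBilin Q b)
  simp only [QuadraticMap.polarBilin_apply_apply] at h
  rw [h]
  congr 1
  refine propext ⟨fun h0 ↦ hB b fun x ↦ ?_, fun h0 ↦ ?_⟩
  · rw [← QuadraticMap.polarBilin_apply_apply, h0]; rfl
  · simp [h0]

/-- Completing the square by `x ↦ x + a⁻¹b`. No division by 2 occurs, so characteristic 2 is
included. -/
theorem sum_addChar_polar_sub {ψ : AddChar F ℂ} {Q : QuadraticForm F V} {E : ℂ}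
    (hG : ∀ a : Fˣ, ∑ x, ψ (a * Q x) = E) (a : Fˣ) (b : V) :
    ∑ x, ψ (QuadraticMap.polar Q b x - a * Q x) = ψ (Q b * (a⁻¹ : Fˣ)) * E := by
  rw [← hG (-a), Finset.mul_sum, ← Equiv.sum_comp (Equiv.addRight (((a⁻¹ : Fˣ) : F) • b))]
  refine Finset.sum_congr rfl fun x _ ↦ ?_
  rw [← AddChar.map_add_eq_mul]
  congr 1
  have h1 : Q (x + ((a⁻¹ : Fˣ) : F) • b) = Q x + (a⁻¹ : Fˣ) * (a⁻¹ : Fˣ) * Q b +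
      (a⁻¹ : Fˣ) * QuadraticMap.polar Q b x := by
    have := QuadraticMap.polar_smul_right Q ((a⁻¹ : Fˣ) : F) x b
    rw [QuadraticMap.polar_comm Q x b] at this
    simp only [QuadraticMap.polar, QuadraticMap.map_smul, smul_eq_mul] at this ⊢
    linear_combination this
  have h2 : QuadraticMap.polar Q b b = 2 * Q b := by
    rw [QuadraticMap.polar_self]; simp [two_mul]
  simp only [Equiv.coe_addRight, QuadraticMap.polar_add_right, QuadraticMap.polar_smul_right, h1,
    h2, smul_eq_mul]
  have h3 : (a : F) * (a⁻¹ : Fˣ) = 1 := by simp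
  push_cast at h3 ⊢
  linear_combination (-(a : F)⁻¹ * Q b - QuadraticMap.polar Q b x) * h3

/-- The value at `b` of the character sum over the set `{x | Q x ∈ cH}`. -/
noncomputable def cosetSum (ψ : AddChar F ℂ) (Q : QuadraticForm F V) (H : Subgroup Fˣ) (c : Fˣ) (b : V) : ℂ :=
  ∑ x, if InCoset H c (Q x) then ψ (QuadraticMap.polar Q b x) else 0

/-- The condition `Q x = ch` is detected by averaging `ψ (a (ch - Q x))` over `a`. The term `a = 0`
gives orthogonality; the others, by completing the square, give Kloosterman sums. -/
theorem card_mul_cosetSum {ψ : AddChar F ℂ} (hψ : ψ ≠ 1) {Q : QuadraticForm F V} {E : ℂ}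
    (hB : ∀ b, (∀ x, QuadraticMap.polar Q b x = 0) → b = 0)
    (hG : ∀ a : Fˣ, ∑ x, ψ (a * Q x) = E) (H : Subgroup Fˣ) (c : Fˣ) (b : V) :
    (Fintype.card F : ℂ) * cosetSum ψ Q H c b =
      (Fintype.card H : ℂ) * (if b = 0 then (Fintype.card V : ℂ) else 0) +
      E * ∑ h : H, ∑ a : Fˣ, ψ (a * (c * h : Fˣ) + Q b * (a⁻¹ : Fˣ)) := by
  have key : ∀ h : H, (Fintype.card F : ℂ) *
      (∑ x, if Q x = ((c * h : Fˣ) : F) then ψ (QuadraticMap.polar Q b x) else 0) =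
      (if b = 0 then (Fintype.card V : ℂ) else 0) +
        E * ∑ a : Fˣ, ψ (a * (c * h : Fˣ) + Q b * (a⁻¹ : Fˣ)) := by
    intro h
    have h1 : (Fintype.card F : ℂ) *
      (∑ x, if Q x = ((c * h : Fˣ) : F) then ψ (QuadraticMap.polar Q b x) else 0) =
        ∑ a : F, ∑ x, ψ (a * (((c * h : Fˣ) : F) - Q x)) * ψ (QuadraticMap.polar Q b x) := by
      rw [Finset.sum_comm, Finset.mul_sum]
      refine Finset.sum_congr rfl fun x _ ↦ ?_
      rw [← Finset.sum_mul, sum_addChar_mul hψ]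
      by_cases hx : Q x = ((c * h : Fˣ) : F)
      · simp [hx]
      · rw [if_neg hx, if_neg fun e ↦ hx (sub_eq_zero.1 e).symm]; simp
    rw [h1, sum_eq_zero_add_sum_units]
    congr 1
    · simp only [zero_mul, AddChar.map_zero_eq_one, one_mul]
      exact sum_addChar_polar hψ hB b
    · rw [Finset.mul_sum]
      refine Finset.sum_congr rfl fun a _ ↦ ?_
      rw [AddChar.map_add_eq_mul, mul_comm E, mul_assoc, ← sum_addChar_polar_sub hG a b,
        Finset.mul_sum]
      refine Finset.sum_congr rfl fun x _ ↦ ?_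
      rw [← AddChar.map_add_eq_mul, ← AddChar.map_add_eq_mul]
      congr 1
      ring
  have h2 : cosetSum ψ Q H c b = ∑ h : H, ∑ x,
      if Q x = ((c * h : Fˣ) : F) then ψ (QuadraticMap.polar Q b x) else 0 := by
    rw [cosetSum, Finset.sum_comm]
    exact Finset.sum_congr rfl fun x _ ↦ sum_ite_inCoset H c _ _
  rw [h2, Finset.mul_sum, Finset.sum_congr rfl fun h _ ↦ key h, Finset.sum_add_distrib,
    ← Finset.mul_sum]
  simp

/-- The duality. For `Q b ≠ 0` it is `TwoValuedPeriods.sum_kloosterman`; for `Q b = 0` each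
Kloosterman sum degenerates to `-1`. -/
theorem cosetSum_eq {ψ : AddChar F ℂ} (hψ : ψ ≠ 1) {Q : QuadraticForm F V} {E : ℂ}
    (hB : ∀ b, (∀ x, QuadraticMap.polar Q b x = 0) → b = 0)
    (hG : ∀ a : Fˣ, ∑ x, ψ (a * Q x) = E) {H : Subgroup Fˣ} {e : ℕ} {n : ℤ} {k : Fˣ}
    (h : TwoValuedPeriods ψ H e n k) (hn : (n : ℂ) ^ 2 = Fintype.card F)
    (hH : (e : ℂ) * Fintype.card H = Fintype.card F - 1) (he : e ≠ 0)
    (hE : E ^ 2 = Fintype.card V) {R : ℂ}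
    (hR : (e : ℂ) * Fintype.card F * R = E * (Fintype.card F - 1)) (c : Fˣ) (b : V) :
    cosetSum ψ Q H c b = -R + (if InCoset H (k ^ 2 * c⁻¹) (Q b) then E else 0) +
      if b = 0 then R * E else 0 := by
  have hq : (Fintype.card F : ℂ) ≠ 0 := by simp
  have he' : (e : ℂ) ≠ 0 := by exact_mod_cast he
  apply mul_left_cancel₀ (mul_ne_zero he' hq)
  rw [mul_assoc, card_mul_cosetSum hψ hB hG, mul_add, ← mul_assoc, hH, mul_left_comm _ E]
  by_cases hb : Q b = 0
  · rw [hb, if_neg not_inCoset_zero]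
    have h1 : ∀ x : H, ∑ a : Fˣ, ψ (a * (c * x : Fˣ) + 0 * (a⁻¹ : Fˣ)) = -1 := by
      intro x
      simpa using sum_units_addChar hψ (c * x)
    rw [Finset.sum_congr rfl fun x _ ↦ h1 x]
    split_ifs
    · rw [← hE]
      simp only [Finset.sum_neg_distrib, Finset.sum_const, Finset.card_univ, nsmul_eq_mul, mul_one]
      linear_combination (1 - E) * hR - E * hH
    · simp only [Finset.sum_neg_distrib, Finset.sum_const, Finset.card_univ, nsmul_eq_mul, mul_one]
      linear_combination hR - E * hH
  · have hb0 : b ≠ 0 := by rintro rfl; simp at hb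
    obtain ⟨t, ht⟩ : ∃ t : Fˣ, (t : F) = Q b := ⟨Units.mk0 _ hb, rfl⟩
    have h1 := h.sum_kloosterman hψ hn c t
    rw [← inCoset_coe] at h1
    rw [← ht, h1, if_neg hb0, if_neg hb0]
    by_cases hi : InCoset H (k ^ 2 * c⁻¹) (t : F)
    · rw [if_pos hi, if_pos hi]
      linear_combination hR
    · rw [if_neg hi, if_neg hi]
      linear_combination hR

end QuadraticCharacterSums

/-! ### Strong regularity from counting representations -/

/-- Since `-D = D`, common neighbours of `u` and `w` correspond to representations of `w - u` as a
sum of two elements of `D`. -/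
theorem isSRCayley_of_card {G : Type*} [AddCommGroup G] [Fintype G] {D : Set G} {v k l μ : ℤ}
    (h0 : (0 : G) ∉ D) (hneg : ∀ x : G, -x ∈ D ↔ x ∈ D) (hv : (Fintype.card G : ℤ) = v)
    (hk : ((Finset.univ.filter (· ∈ D)).card : ℤ) = k)
    (hN : ∀ z : G, z ≠ 0 → ((Finset.univ.filter fun x ↦ x ∈ D ∧ z - x ∈ D).card : ℤ) =
      if z ∈ D then l else μ) (hl : 0 ≤ l) (hμ : 0 ≤ μ) : IsSRCayley D v k l μ := by
  have hadj : ∀ u w : G, (SimpleGraph.addCayley D).Adj u w ↔ w - u ∈ D := by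
    intro u w
    rw [SimpleGraph.addCayley_adj']
    constructor
    · rintro ⟨-, g, hg, rfl | rfl⟩
      · simpa using hg
      · rw [← hneg]; simpa using hg
    · intro h
      refine ⟨?_, w - u, h, Or.inl (by abel)⟩
      rintro rfl
      simp [h0] at h
  have hcn : ∀ u w : G, Fintype.card ((SimpleGraph.addCayley D).commonNeighbors u w) =
      (Finset.univ.filter fun x ↦ x ∈ D ∧ (w - u) - x ∈ D).card := by
    intro u w
    rw [← Set.toFinset_card]
    refine Finset.card_bij' (fun x _ ↦ x - u) (fun x _ ↦ x + u) ?_ ?_ ?_ ?_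
    · intro x hx
      simp only [Set.mem_toFinset, SimpleGraph.mem_commonNeighbors, hadj] at hx
      simp only [Finset.mem_filter, Finset.mem_univ, true_and]
      refine ⟨hx.1, ?_⟩
      rw [← hneg]
      convert hx.2 using 1
      abel
    · intro x hx
      simp only [Finset.mem_filter, Finset.mem_univ, true_and] at hx
      simp only [Set.mem_toFinset, SimpleGraph.mem_commonNeighbors, hadj]
      refine ⟨by simpa using hx.1, ?_⟩
      rw [← hneg]
      convert hx.2 using 1
      abel
    · simp
    · simp
  lift l to ℕ using hl
  lift μ to ℕ using hμ
  refine ⟨h0, hneg, Fintype.card G, _, l, μ, hv, hk, rfl, rfl, rfl, ?_, ?_, ?_⟩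
  · intro u
    rw [← SimpleGraph.card_neighborFinset_eq_degree]
    refine Finset.card_bij' (fun x _ ↦ x - u) (fun x _ ↦ x + u) ?_ ?_ ?_ ?_ <;>
      simp [hadj]
  · intro u w h
    rw [hadj] at h
    have := hN (w - u) (by rintro e; rw [e] at h; exact h0 h)
    rw [if_pos h] at this
    rw [hcn]
    exact_mod_cast this
  · intro u w huw h
    rw [hadj] at h
    have := hN (w - u) (sub_ne_zero.2 huw.symm)
    rw [if_neg h] at this
    rw [hcn]
    exact_mod_cast this

section Counting

variable {F V : Type*} [Field F] [Fintype F] [AddCommGroup V] [Module F V] [Fintype V]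

/-- Fourier inversion for the convolution of the indicator of `D` with itself. -/
theorem card_mul_card_eq_sum_cosetSum_sq {ψ : AddChar F ℂ} (hψ : ψ ≠ 1) {Q : QuadraticForm F V}
    (hB : ∀ b, (∀ x, QuadraticMap.polar Q b x = 0) → b = 0) (H : Subgroup Fˣ) (c : Fˣ) (z : V) :
    (Fintype.card V : ℂ) *
      (Finset.univ.filter fun x ↦ InCoset H c (Q x) ∧ InCoset H c (Q (z - x))).card =
      ∑ b, cosetSum ψ Q H c b ^ 2 * ψ (QuadraticMap.polar Q b (-z)) := by
  have h1 : ∀ b, cosetSum ψ Q H c b ^ 2 * ψ (QuadraticMap.polar Q b (-z)) =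
      ∑ x, ∑ y, if InCoset H c (Q x) ∧ InCoset H c (Q y) then
        ψ (QuadraticMap.polar Q (x + y - z) b) else 0 := by
    intro b
    rw [cosetSum, sq, Finset.sum_mul_sum, Finset.sum_mul]
    refine Finset.sum_congr rfl fun x _ ↦ ?_
    rw [Finset.sum_mul]
    refine Finset.sum_congr rfl fun y _ ↦ ?_
    rw [QuadraticMap.polar_comm Q _ b, sub_eq_add_neg, QuadraticMap.polar_add_right,
      QuadraticMap.polar_add_right, AddChar.map_add_eq_mul, AddChar.map_add_eq_mul]
    by_cases hx : InCoset H c (Q x) <;> by_cases hy : InCoset H c (Q y) <;> simp [hx, hy]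
  rw [Finset.sum_congr rfl fun b _ ↦ h1 b, Finset.sum_comm]
  have h2 : ∀ x, (∑ b, ∑ y, if InCoset H c (Q x) ∧ InCoset H c (Q y) then
        ψ (QuadraticMap.polar Q (x + y - z) b) else 0) =
      if InCoset H c (Q x) ∧ InCoset H c (Q (z - x)) then (Fintype.card V : ℂ) else 0 := by
    intro x
    rw [Finset.sum_comm, Finset.sum_eq_single (z - x)]
    · split_ifs
      · rw [sum_addChar_polar hψ hB, if_pos (by abel)]
      · simp
    · intro y _ hy
      split_ifs
      · rw [sum_addChar_polar hψ hB, if_neg]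
        intro e
        apply hy
        rw [eq_sub_iff_add_eq, add_comm]
        exact sub_eq_zero.1 e
      · simp
    · simp
  rw [Finset.sum_congr rfl fun x _ ↦ h2 x, Finset.sum_ite]
  simp [mul_comm]

theorem isLatinTypeCayley_of_twoValuedPeriods {ψ : AddChar F ℂ} (hψ : ψ ≠ 1)
    {Q : QuadraticForm F V} {ε N : ℤ} (hε : ε = 1 ∨ ε = -1) (hN : 2 ≤ N)
    (hB : ∀ b, (∀ x, QuadraticMap.polar Q b x = 0) → b = 0)
    (hG : ∀ a : Fˣ, ∑ x, ψ (a * Q x) = ε * N) {H : Subgroup Fˣ} {e : ℕ} {n : ℤ} {k : Fˣ}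
    (h : TwoValuedPeriods ψ H e n k) (hn : n ^ 2 = Fintype.card F)
    (hH : e * Fintype.card H + 1 = Fintype.card F) (he : e ≠ 0)
    (hV : N ^ 2 = Fintype.card V) {r : ℕ} (hr0 : 1 ≤ r)
    (hr : (r * e * Fintype.card F : ℤ) = N * (Fintype.card F - 1)) (c : Fˣ) :
    IsLatinTypeCayley {x | InCoset H c (Q x)} ε N r := by
  have hε2 : (ε : ℂ) ^ 2 = 1 := by rcases hε with rfl | rfl <;> simp
  have hN0 : (N : ℂ) ≠ 0 := by
    have : N ≠ 0 := by omega
    exact_mod_cast this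
  have hn' : (n : ℂ) ^ 2 = Fintype.card F := by exact_mod_cast hn
  have hH' : (e : ℂ) * Fintype.card H = Fintype.card F - 1 := by
    rw [eq_sub_iff_add_eq]; exact_mod_cast hH
  have hV' : (N : ℂ) ^ 2 = Fintype.card V := by exact_mod_cast hV
  have hE : ((ε : ℂ) * N) ^ 2 = Fintype.card V := by rw [mul_pow, hε2, hV', one_mul]
  have hr' : (r : ℂ) * e * Fintype.card F = N * (Fintype.card F - 1) := by exact_mod_cast hr
  have hf := cosetSum_eq hψ hB hG h hn' hH' he hE (R := ε * r) (by linear_combination ε * hr')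
  have hk : ((Finset.univ.filter fun x ↦ InCoset H c (Q x)).card : ℤ) = r * (N - ε) := by
    have h1 := hf c 0
    rw [if_pos rfl, QuadraticMap.map_zero, if_neg not_inCoset_zero] at h1
    have h2 : cosetSum ψ Q H c 0 = (Finset.univ.filter fun x ↦ InCoset H c (Q x)).card := by
      simp [cosetSum]
    rw [h2] at h1
    have h3 : ((Finset.univ.filter fun x ↦ InCoset H c (Q x)).card : ℂ) = r * (N - ε) := by
      linear_combination h1 + r * N * hε2
    exact_mod_cast h3
  have hcount : ∀ z : V, z ≠ 0 →
      ((Finset.univ.filter fun x ↦ InCoset H c (Q x) ∧ InCoset H c (Q (z - x))).card : ℤ) =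
      if InCoset H c (Q z) then ε * N + r ^ 2 - 3 * ε * r else r ^ 2 - ε * r := by
    intro z hz
    have h1 := card_mul_card_eq_sum_cosetSum_sq hψ hB H c z
    -- An indicator is its own square, so the squared transform is again a constant, a multiple of
    -- the dual indicator and a term at `b = 0`.
    have h2 : ∀ b, cosetSum ψ Q H c b ^ 2 * ψ (QuadraticMap.polar Q b (-z)) =
        (ε * r : ℂ) ^ 2 * ψ (QuadraticMap.polar Q (-z) b) +
        ((ε * N : ℂ) ^ 2 - 2 * (ε * r) * (ε * N)) *
          (if InCoset H (k ^ 2 * c⁻¹) (Q b) then ψ (QuadraticMap.polar Q (-z) b) else 0) +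
        if b = 0 then ((ε * r : ℂ) ^ 2 * (ε * N) ^ 2 - 2 * (ε * r) ^ 2 * (ε * N)) else 0 := by
      intro b
      rw [hf, QuadraticMap.polar_comm Q b]
      by_cases hb : b = 0
      · subst hb
        rw [if_pos rfl, if_pos rfl, QuadraticMap.map_zero, if_neg not_inCoset_zero,
          if_neg not_inCoset_zero]
        simp only [QuadraticMap.polar_zero_right, AddChar.map_zero_eq_one]
        ring
      · rw [if_neg hb, if_neg hb]
        split_ifs <;> ring
    rw [Finset.sum_congr rfl fun b _ ↦ h2 b, Finset.sum_add_distrib, Finset.sum_add_distrib,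
      ← Finset.mul_sum, ← Finset.mul_sum, sum_addChar_polar hψ hB, if_neg (neg_ne_zero.2 hz)] at h1
    -- The remaining sum is the transform of the dual set, so the duality applies a second time and
    -- leads back to the coset of `c`.
    change _ = _ + _ * cosetSum ψ Q H (k ^ 2 * c⁻¹) (-z) + _ at h1
    rw [hf, if_neg (neg_ne_zero.2 hz), QuadraticMap.map_neg,
      show k ^ 2 * (k ^ 2 * c⁻¹)⁻¹ = c by simp] at h1
    simp only [Finset.sum_ite_eq', Finset.mem_univ, if_true] at h1
    rw [← hV'] at h1
    by_cases hz' : InCoset H c (Q z)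
    · rw [if_pos hz'] at h1 ⊢
      have h3 : ((Finset.univ.filter fun x ↦
          InCoset H c (Q x) ∧ InCoset H c (Q (z - x))).card : ℂ) =
          ε * N + r ^ 2 - 3 * ε * r := by
        apply mul_left_cancel₀ (pow_ne_zero 2 hN0)
        rw [h1]
        rcases hε with rfl | rfl <;> push_cast <;> ring
      exact_mod_cast h3
    · rw [if_neg hz'] at h1 ⊢
      have h3 : ((Finset.univ.filter fun x ↦
          InCoset H c (Q x) ∧ InCoset H c (Q (z - x))).card : ℂ) = r ^ 2 - ε * r := by
        apply mul_left_cancel₀ (pow_ne_zero 2 hN0)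
        rw [h1]
        rcases hε with rfl | rfl <;> push_cast <;> ring
      exact_mod_cast h3
  have h0 : (0 : V) ∉ {x | InCoset H c (Q x)} := by
    simpa using not_inCoset_zero
  refine isSRCayley_of_card h0 (fun x ↦ by simp) hV.symm (by simpa using hk)
    (fun z hz ↦ by simpa using hcount z hz) ?_ ?_
  -- The parameter `l` is nonnegative because it is an actual count at some `z ∈ D`; such a `z`
  -- exists since the valency is positive.
  · obtain ⟨z, hz⟩ : ∃ z, InCoset H c (Q z) := by
      by_contra! hne
      have h1 : 0 < (r : ℤ) * (N - ε) := by
        apply mul_pos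
        · exact_mod_cast hr0
        · rcases hε with rfl | rfl <;> omega
      rw [← hk] at h1
      simp [hne] at h1
    have h1 := hcount z (by rintro rfl; simp [not_inCoset_zero] at hz)
    rw [if_pos hz] at h1
    rw [← h1]
    positivity
  · have : (1 : ℤ) ≤ r := by exact_mod_cast hr0
    rcases hε with rfl | rfl <;> nlinarith

end Counting

/-- `H` lies in the kernel of the `|H|`-th power map, which in a cyclic group has exactly `|H|`
elements. -/
theorem IsCyclic.mem_subgroup_iff_pow_card {G : Type*} [CommGroup G] [IsCyclic G] [Finite G]
    (H : Subgroup G) (x : G) : x ∈ H ↔ x ^ Nat.card H = 1 := by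
  have hle : H ≤ (powMonoidHom (Nat.card H) : G →* G).ker := by
    intro y hy
    rw [MonoidHom.mem_ker, powMonoidHom_apply]
    have := congrArg Subtype.val (pow_card_eq_one' (x := (⟨y, hy⟩ : H)))
    rwa [SubmonoidClass.coe_pow, OneMemClass.coe_one] at this
  have hcard : Nat.card (powMonoidHom (Nat.card H) : G →* G).ker = Nat.card H := by
    rw [IsCyclic.card_powMonoidHom_ker]
    exact Nat.gcd_eq_right (Subgroup.card_subgroup_dvd_card H)
  have heq : H = (powMonoidHom (Nat.card H) : G →* G).ker :=
    Subgroup.eq_of_le_of_card_ge hle hcard.le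
  conv_lhs => rw [heq]
  rw [MonoidHom.mem_ker, powMonoidHom_apply]

theorem IsCyclic.subgroup_eq_of_index_eq {G : Type*} [CommGroup G] [IsCyclic G] [Finite G]
    {H K : Subgroup G} (h : H.index = K.index) : H = K := by
  have h1 : Nat.card H = Nat.card K := by
    apply Nat.eq_of_mul_eq_mul_right (Nat.pos_of_ne_zero (Subgroup.index_ne_zero_of_finite (H := H)))
    rw [H.card_mul_index, h, K.card_mul_index]
  ext x
  rw [mem_subgroup_iff_pow_card H, mem_subgroup_iff_pow_card K, h1]

theorem card_mul_card_subgroup_units {F : Type*} [Field F] [Fintype F] (H : Subgroup Fˣ) {e : ℕ}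
    (hH : H.index = e) : e * Fintype.card H + 1 = Fintype.card F := by
  have h1 := H.card_mul_index
  rw [hH, Nat.card_eq_fintype_card, Nat.card_eq_fintype_card, Fintype.card_units] at h1
  have := Fintype.card_pos (α := F)
  rw [mul_comm, h1]
  omega

/-! ### Two-valued periods when `e` divides `|K| + 1` -/

section Quadratic

variable {K F : Type*} [Field K] [Fintype K] [Field F] [Fintype F] [Algebra K F]

theorem map_units_le_of_index_dvd (hKF : Fintype.card F = Fintype.card K ^ 2) {H : Subgroup Fˣ}
    (he : H.index ∣ Fintype.card K + 1) (x : Kˣ) : Units.map (algebraMap K F).toMonoidHom x ∈ H := by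
  rw [IsCyclic.mem_subgroup_iff_pow_card, ← map_pow]
  obtain ⟨d, hd⟩ := he
  have h1 := card_mul_card_subgroup_units H rfl
  have h2 : Fintype.card K ^ 2 = (Fintype.card K + 1) * (Fintype.card K - 1) + 1 := by
    have := Fintype.card_pos (α := K)
    obtain ⟨k, hk⟩ := Nat.exists_eq_add_of_lt this
    rw [hk]; simp; ring
  have h3 : Nat.card H = (Fintype.card K - 1) * d := by
    apply Nat.eq_of_mul_eq_mul_left
      (Nat.pos_of_ne_zero (Subgroup.index_ne_zero_of_finite (H := H)))
    rw [Nat.card_eq_fintype_card]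
    have : H.index * Fintype.card H = (Fintype.card K + 1) * (Fintype.card K - 1) := by omega
    rw [this, hd]; ring
  rw [h3, pow_mul, ← Fintype.card_units, pow_card_eq_one, one_pow, map_one]

/-- The `x` for which `ψ` is trivial on `xK` form a set `L` stable under `K`; double counting gives
`|L| = |K|`, so `L = kK` for any nonzero `k ∈ L`. -/
theorem exists_sum_addChar_algebraMap (hKF : Fintype.card F = Fintype.card K ^ 2)
    {ψ : AddChar F ℂ} (hψ : ψ ≠ 1) : ∃ k : Fˣ, ∀ x : Fˣ,
      ∑ a : Kˣ, ψ (x * algebraMap K F a) = -1 + Fintype.card K *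
        ∑ a : Kˣ, if x = k * Units.map (algebraMap K F).toMonoidHom a then 1 else 0 := by
  have h1 : ∀ x : F, ∑ a : K, ψ (x * algebraMap K F a) =
      if ∀ a : K, ψ (x * algebraMap K F a) = 1 then (Fintype.card K : ℂ) else 0 := by
    intro x
    have h := AddChar.sum_eq_ite (ψ.compAddMonoidHom
      ((AddMonoidHom.mulLeft x).comp (algebraMap K F).toAddMonoidHom))
    simp only [AddChar.compAddMonoidHom_apply, AddMonoidHom.comp_apply] at h
    simp only [AddChar.eq_zero_iff] at h
    convert! h using 1
  set L : Finset F := Finset.univ.filter fun x ↦ ∀ a : K, ψ (x * algebraMap K F a) = 1 with hL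
  have hmem : ∀ x, x ∈ L ↔ ∀ a : K, ψ (x * algebraMap K F a) = 1 := by simp [hL]
  have hcard : L.card = Fintype.card K := by
    have h2 : ∑ a : K, ∑ x : F, ψ (x * algebraMap K F a) = (Fintype.card F : ℂ) := by
      rw [Finset.sum_congr rfl fun a _ ↦ sum_addChar_mul hψ (algebraMap K F a)]
      simp
    rw [Finset.sum_comm, Finset.sum_congr rfl fun x _ ↦ h1 x, Finset.sum_ite] at h2
    simp only [Finset.sum_const, nsmul_eq_mul, mul_zero, add_zero, hKF] at h2
    have h3 : L.card * Fintype.card K = Fintype.card K ^ 2 := by exact_mod_cast h2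
    rw [sq] at h3
    exact Nat.eq_of_mul_eq_mul_right Fintype.card_pos h3
  obtain ⟨k, hk, hk0⟩ : ∃ k ∈ L, k ≠ 0 := by
    apply Finset.exists_mem_ne
    rw [hcard]
    exact Fintype.one_lt_card
  have himg : Finset.univ.image (fun a : K ↦ k * algebraMap K F a) = L := by
    apply Finset.eq_of_subset_of_card_le
    · intro y hy
      obtain ⟨a, -, rfl⟩ := Finset.mem_image.1 hy
      rw [hmem] at hk ⊢
      intro b
      rw [mul_assoc, ← map_mul]
      exact hk _
    · rw [hcard, Finset.card_image_of_injective, Finset.card_univ]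
      intro a b hab
      exact (algebraMap K F).injective (mul_left_cancel₀ hk0 hab)
  refine ⟨Units.mk0 k hk0, fun x ↦ ?_⟩
  have h2 := h1 x
  rw [sum_eq_zero_add_sum_units] at h2
  simp only [map_zero, mul_zero, AddChar.map_zero_eq_one] at h2
  have h3 : (∑ a : Kˣ, if x = Units.mk0 k hk0 * Units.map (algebraMap K F).toMonoidHom a
      then (1 : ℂ) else 0) = if ∀ a : K, ψ (x * algebraMap K F a) = 1 then 1 else 0 := by
    split_ifs with hx
    · rw [← hmem, ← himg, Finset.mem_image] at hx
      obtain ⟨a, -, ha⟩ := hx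
      have ha0 : a ≠ 0 := by
        rintro rfl
        simp at ha
        exact x.ne_zero ha.symm
      rw [Finset.sum_eq_single (Units.mk0 a ha0)]
      · rw [if_pos]
        ext
        simpa using ha.symm
      · intro b _ hb
        rw [if_neg]
        intro hx
        apply hb
        ext
        have := congrArg Units.val hx
        rw [← ha] at this
        simpa [hk0] using this.symm
      · simp
    · refine Finset.sum_eq_zero fun a _ ↦ if_neg ?_
      rintro rfl
      apply hx
      rw [← hmem, ← himg]
      exact Finset.mem_image.2 ⟨a, Finset.mem_univ _, by simp⟩
  rw [h3]
  split_ifs at h2 ⊢ <;> linear_combination h2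

/-- As `Kˣ ≤ H`, a period may be averaged over `Kˣ`. The coset `kKˣ` then lies wholly inside `cH` or
misses it. -/
theorem exists_twoValuedPeriods_of_index_dvd (hKF : Fintype.card F = Fintype.card K ^ 2)
    {ψ : AddChar F ℂ} (hψ : ψ ≠ 1) {H : Subgroup Fˣ} {e : ℕ} (hH : H.index = e)
    (he : e ∣ Fintype.card K + 1) : ∃ k : Fˣ, TwoValuedPeriods ψ H e (Fintype.card K) k := by
  obtain ⟨k, hk⟩ := exists_sum_addChar_algebraMap hKF hψ
  refine ⟨k, fun c ↦ ?_⟩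
  have hmap := map_units_le_of_index_dvd hKF (H := H) (by rwa [hH])
  have h1 : ((Fintype.card K : ℂ) - 1) * ∑ h : H, ψ ((c * h : Fˣ) : F) =
      ∑ h : H, ∑ a : Kˣ, ψ ((c * h : Fˣ) * algebraMap K F a) := by
    rw [Finset.sum_comm]
    have h2 : ∀ a : Kˣ, ∑ h : H, ψ ((c * h : Fˣ) * algebraMap K F a) =
        ∑ h : H, ψ ((c * h : Fˣ) : F) := by
      intro a
      refine (Finset.sum_congr rfl fun h _ ↦ ?_).trans
        (Equiv.sum_comp (Equiv.mulRight (⟨_, hmap a⟩ : H)) fun h : H ↦ ψ ((c * h : Fˣ) : F))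
      simp [mul_assoc]
    rw [Finset.sum_congr rfl fun a _ ↦ h2 a, Finset.sum_const, Finset.card_univ,
      Fintype.card_units, nsmul_eq_mul, Nat.cast_sub Fintype.card_pos, Nat.cast_one]
  have h3 : (∑ h : H, ∑ a : Kˣ,
      if c * h = k * Units.map (algebraMap K F).toMonoidHom a then (1 : ℂ) else 0) =
      ((Fintype.card K : ℂ) - 1) * if c * k⁻¹ ∈ H then 1 else 0 := by
    rw [Finset.sum_comm]
    have h4 : ∀ a : Kˣ, (∑ h : H,
        if c * h = k * Units.map (algebraMap K F).toMonoidHom a then (1 : ℂ) else 0) =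
        if c * k⁻¹ ∈ H then 1 else 0 := by
      intro a
      split_ifs with hc
      · have hm : c⁻¹ * k * Units.map (algebraMap K F).toMonoidHom a ∈ H := by
          refine H.mul_mem ?_ (hmap a)
          have := H.inv_mem hc
          rwa [mul_inv, inv_inv] at this
        rw [Finset.sum_eq_single (⟨_, hm⟩ : H)]
        · rw [if_pos]
          simp [mul_assoc]
        · intro b _ hb
          rw [if_neg]
          intro e
          apply hb
          ext1
          simp only
          rw [mul_assoc, ← e, inv_mul_cancel_left]
        · simp
      · refine Finset.sum_eq_zero fun h _ ↦ if_neg fun e ↦ hc ?_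
        have : c * k⁻¹ = Units.map (algebraMap K F).toMonoidHom a * (h : Fˣ)⁻¹ := by
          rw [mul_inv_eq_iff_eq_mul, mul_right_comm, mul_comm _ k, ← e, mul_inv_cancel_right]
        rw [this]
        exact H.mul_mem (hmap a) (H.inv_mem h.2)
    rw [Finset.sum_congr rfl fun a _ ↦ h4 a, Finset.sum_const, Finset.card_univ,
      Fintype.card_units, nsmul_eq_mul, Nat.cast_sub Fintype.card_pos, Nat.cast_one]
  rw [Finset.sum_congr rfl fun (h : H) _ ↦ hk (c * h), Finset.sum_add_distrib, ← Finset.mul_sum, h3]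
    at h1
  have h5 : (e : ℂ) * Fintype.card H = Fintype.card K ^ 2 - 1 := by
    rw [eq_sub_iff_add_eq]
    exact_mod_cast (card_mul_card_subgroup_units H hH).trans hKF
  have h6 : (Fintype.card K : ℂ) - 1 ≠ 0 := by
    rw [sub_ne_zero]
    exact_mod_cast (Fintype.one_lt_card (α := K)).ne'
  apply mul_left_cancel₀ h6
  simp only [Finset.sum_const, Finset.card_univ, nsmul_eq_mul] at h1
  rw [Int.cast_natCast, mul_left_comm, h1]
  split_ifs <;> linear_combination -h5

end Quadratic

/-! ### Norm forms and the passage to a quadratic extension -/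

section NormForm

variable {K F : Type*} [Field K] [Fintype K] [Field F] [Fintype F] [Algebra K F]

theorem finrank_eq_two_of_card (hKF : Fintype.card F = Fintype.card K ^ 2) :
    Module.finrank K F = 2 := by
  have h := Module.card_eq_pow_finrank (K := K) (V := F)
  rw [hKF] at h
  exact (Nat.pow_right_injective Fintype.one_lt_card h).symm

theorem algebraMap_norm_quadratic (hKF : Fintype.card F = Fintype.card K ^ 2) (x : F) :
    algebraMap K F (Algebra.norm K x) = x * FiniteField.frobeniusAlgHom K F x := by
  rw [FiniteField.algebraMap_norm_eq_prod_pow, finrank_eq_two_of_card hKF]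
  simp [Finset.prod_range_succ]

theorem algebraMap_trace_quadratic (hKF : Fintype.card F = Fintype.card K ^ 2) (x : F) :
    algebraMap K F (Algebra.trace K F x) = x + FiniteField.frobeniusAlgHom K F x := by
  rw [FiniteField.algebraMap_trace_eq_sum_pow, finrank_eq_two_of_card hKF]
  simp [Finset.sum_range_succ]

theorem frobeniusAlgHom_frobeniusAlgHom (hKF : Fintype.card F = Fintype.card K ^ 2) (x : F) :
    FiniteField.frobeniusAlgHom K F (FiniteField.frobeniusAlgHom K F x) = x := by
  simp only [FiniteField.frobeniusAlgHom_apply]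
  rw [← pow_mul, ← sq, ← hKF, FiniteField.pow_card]

theorem polar_norm (hKF : Fintype.card F = Fintype.card K ^ 2) (x y : F) :
    QuadraticMap.polar (Algebra.norm K : F → K) x y =
      Algebra.trace K F (x * FiniteField.frobeniusAlgHom K F y) := by
  apply (algebraMap K F).injective
  rw [algebraMap_trace_quadratic hKF, QuadraticMap.polar]
  simp only [map_sub, algebraMap_norm_quadratic hKF, map_mul, map_add,
    frobeniusAlgHom_frobeniusAlgHom hKF]
  ring

/-- The norm form of a quadratic extension of finite fields. -/
noncomputable def normForm (hKF : Fintype.card F = Fintype.card K ^ 2) : QuadraticForm K F :=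
  QuadraticMap.ofPolar (Algebra.norm K)
    (fun a x ↦ by
      rw [Algebra.smul_def, map_mul, Algebra.norm_algebraMap, finrank_eq_two_of_card hKF, sq,
        smul_eq_mul])
    (fun x x' y ↦ by simp only [polar_norm hKF, add_mul, map_add])
    (fun a x y ↦ by simp only [polar_norm hKF, smul_mul_assoc, map_smul])

theorem normForm_apply (hKF : Fintype.card F = Fintype.card K ^ 2) (x : F) :
    normForm hKF x = Algebra.norm K x := rfl

theorem polar_normForm (hKF : Fintype.card F = Fintype.card K ^ 2) (x y : F) :
    QuadraticMap.polar (normForm hKF) x y =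
      Algebra.trace K F (x * FiniteField.frobeniusAlgHom K F y) :=
  polar_norm hKF x y

theorem normForm_nondegenerate (hKF : Fintype.card F = Fintype.card K ^ 2) (b : F)
    (h : ∀ x, QuadraticMap.polar (normForm hKF) b x = 0) : b = 0 := by
  by_contra hb
  apply Algebra.trace_ne_zero K F
  ext y
  have h1 := h (FiniteField.frobeniusAlgHom K F (y / b))
  rwa [polar_normForm, frobeniusAlgHom_frobeniusAlgHom hKF, mul_div_cancel₀ _ hb] at h1

/-- Surjectivity of the norm on units makes the sum independent of `a`. Summing over all `a : K`
counts zeros of the norm, of which there is one, and this fixes the common value. -/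
theorem sum_addChar_norm (hKF : Fintype.card F = Fintype.card K ^ 2) {ψ : AddChar K ℂ}
    (hψ : ψ ≠ 1) (a : Kˣ) : ∑ x : F, ψ (a * Algebra.norm K x) = -Fintype.card K := by
  have h1 : ∀ a : Kˣ, ∑ x : F, ψ (a * Algebra.norm K x) = ∑ x : F, ψ (Algebra.norm K x) := by
    intro a
    obtain ⟨b, rfl⟩ := FiniteField.unitsMap_norm_surjective K F a
    rw [← Equiv.sum_comp (Units.mulLeft b) fun x : F ↦ ψ (Algebra.norm K x)]
    simp
  have h2 : ∑ a : K, ∑ x : F, ψ (a * Algebra.norm K x) = Fintype.card K := by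
    rw [Finset.sum_comm, Finset.sum_congr rfl fun x _ ↦ sum_addChar_mul hψ (Algebra.norm K x)]
    simp [Algebra.norm_eq_zero_iff]
  rw [sum_eq_zero_add_sum_units, Finset.sum_congr rfl fun a _ ↦ h1 a] at h2
  simp only [zero_mul, AddChar.map_zero_eq_one, Finset.sum_const, Finset.card_univ, nsmul_eq_mul,
    mul_one, Fintype.card_units] at h2
  rw [Nat.cast_sub Fintype.card_pos, hKF] at h2
  have h6 : (Fintype.card K : ℂ) - 1 ≠ 0 := by
    rw [sub_ne_zero]
    exact_mod_cast (Fintype.one_lt_card (α := K)).ne'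
  rw [h1]
  apply mul_left_cancel₀ h6
  push_cast at h2
  linear_combination h2

/-- The period of `H'` at `c` is the coset sum of the norm form at the Frobenius conjugate of `c`,
because the polar form is `Tr (x ȳ)`. The duality with `E = -|K|` gives the new `n = -|K|`; the
exceptional coset is again that of `k`, since `N(k) = k²`. -/
theorem TwoValuedPeriods.comp_trace (hKF : Fintype.card F = Fintype.card K ^ 2)
    {ψ : AddChar K ℂ} (hψ : ψ ≠ 1) {H : Subgroup Kˣ} {e : ℕ} {n : ℤ} {k : Kˣ}
    (h : TwoValuedPeriods ψ H e n k) (hn : n ^ 2 = Fintype.card K) (hH : H.index = e)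
    {H' : Subgroup Fˣ} (hH' : H'.index = e) :
    ∃ k', TwoValuedPeriods (ψ.compAddMonoidHom (Algebra.trace K F).toAddMonoidHom) H' e
      (-Fintype.card K) k' := by
  -- A finite cyclic group has only one subgroup of each index, so `H'` must be the norm preimage of
  -- `H`.
  have hcomap : H' = H.comap (Units.map (Algebra.norm K (S := F))) := by
    apply IsCyclic.subgroup_eq_of_index_eq
    rw [H.index_comap_of_surjective (FiniteField.unitsMap_norm_surjective K F), hH, hH']
  have he : e ≠ 0 := hH ▸ Subgroup.index_ne_zero_of_finite
  have he' : (e : ℂ) ≠ 0 := by exact_mod_cast he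
  have hKF' : (Fintype.card F : ℂ) = Fintype.card K ^ 2 := by exact_mod_cast hKF
  refine ⟨Units.map (algebraMap K F).toMonoidHom k, fun c ↦ ?_⟩
  have key := cosetSum_eq hψ (normForm_nondegenerate hKF)
    (fun a ↦ sum_addChar_norm hKF hψ a) h (by exact_mod_cast hn)
    (by rw [eq_sub_iff_add_eq]; exact_mod_cast card_mul_card_subgroup_units H hH) he
    (by rw [hKF']; ring) (R := -(Fintype.card K - 1) / e) (by field_simp) 1
    (FiniteField.frobeniusAlgHom K F c)
  have hnc : Algebra.norm K (FiniteField.frobeniusAlgHom K F (c : F)) =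
      ((Units.map (Algebra.norm K (S := F)) c : Kˣ) : K) := by
    apply (algebraMap K F).injective
    rw [Units.coe_map]
    change _ = algebraMap K F (Algebra.norm K (c : F))
    rw [algebraMap_norm_quadratic hKF, algebraMap_norm_quadratic hKF,
      frobeniusAlgHom_frobeniusAlgHom hKF, mul_comm]
  have hiff : InCoset H (k ^ 2 * 1⁻¹) (normForm hKF (FiniteField.frobeniusAlgHom K F (c : F))) ↔
      c * (Units.map (algebraMap K F).toMonoidHom k)⁻¹ ∈ H' := by
    rw [normForm_apply, hnc, inCoset_coe, hcomap, Subgroup.mem_comap, map_mul, map_inv]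
    have : Units.map (Algebra.norm K (S := F)) (Units.map (algebraMap K F).toMonoidHom k) =
        k ^ 2 := by
      ext
      simp [Algebra.norm_algebraMap, finrank_eq_two_of_card hKF]
    rw [this, inv_one, mul_one, mul_comm]
  have hc0 : FiniteField.frobeniusAlgHom K F (c : F) ≠ 0 := by
    rw [Ne, map_eq_zero]
    exact c.ne_zero
  have hsum : cosetSum ψ (normForm hKF) H 1 (FiniteField.frobeniusAlgHom K F c) =
      ∑ h : H', (ψ.compAddMonoidHom (Algebra.trace K F).toAddMonoidHom) ((c * h : Fˣ) : F) := by
    have h1 := sum_ite_mem_subgroup H' 1 fun x ↦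
      (ψ.compAddMonoidHom (Algebra.trace K F).toAddMonoidHom) ((c * x : Fˣ) : F)
    simp only [one_mul, inv_one] at h1
    rw [← h1, cosetSum, sum_eq_zero_add_sum_units, QuadraticMap.map_zero, if_neg not_inCoset_zero,
      zero_add]
    refine Finset.sum_congr rfl fun x _ ↦ ?_
    have h2 : InCoset H 1 (normForm hKF (x : F)) ↔ x ∈ H' := by
      rw [hcomap, Subgroup.mem_comap]
      have := inCoset_coe (H := H) (c := 1) (t := Units.map (Algebra.norm K (S := F)) x)
      rwa [inv_one, one_mul] at this
    rw [QuadraticMap.polar_comm, polar_normForm, frobeniusAlgHom_frobeniusAlgHom hKF]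
    by_cases hx : x ∈ H'
    · rw [if_pos (h2.2 hx), if_pos hx]
      simp [mul_comm]
    · rw [if_neg (mt h2.1 hx), if_neg hx]
  rw [hsum, if_neg hc0] at key
  rw [key]
  by_cases hc : c * (Units.map (algebraMap K F).toMonoidHom k)⁻¹ ∈ H'
  · rw [if_pos (hiff.2 hc), if_pos hc]
    push_cast
    field_simp
    ring
  · rw [if_neg (mt hiff.1 hc), if_neg hc]
    push_cast
    field_simp
    ring

end NormForm

/-! ### Two-valued periods along a tower of quadratic extensions -/

/-- The subfield is the fixed field of `x ↦ x ^ p ^ J`; its units are the kernel of a power map on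
the cyclic group `Fˣ`, which gives the count. -/
theorem exists_subfield_card_eq {F : Type*} [Field F] [Fintype F] {p J : ℕ} (hp : p.Prime)
    (hF : Fintype.card F = (p ^ J) ^ 2) (hJ : J ≠ 0) :
    ∃ K : Subfield F, Fintype.card K = p ^ J := by
  have hchar : CharP F p := by
    have := Fact.mk hp
    exact charP_of_card_eq_prime_pow (f := J * 2) (by rw [hF, pow_mul])
  have : ExpChar F p := .prime hp
  have hq : 1 < p ^ J := Nat.one_lt_pow hJ hp.one_lt
  let K : Subfield F :=
    { carrier := {x | x ^ p ^ J = x}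
      zero_mem' := zero_pow (by omega)
      one_mem' := one_pow _
      add_mem' := fun {x y} hx hy ↦ by
        simp only [Set.mem_ofPred_eq] at hx hy ⊢
        rw [add_pow_expChar_pow, hx, hy]
      mul_mem' := fun {x y} hx hy ↦ by
        simp only [Set.mem_ofPred_eq] at hx hy ⊢
        rw [mul_pow, hx, hy]
      neg_mem' := fun {x} hx ↦ by
        simp only [Set.mem_ofPred_eq] at hx ⊢
        rw [← zero_sub, sub_pow_expChar_pow, hx, zero_pow (by omega)]
      inv_mem' := fun x hx ↦ by
        simp only [Set.mem_ofPred_eq] at hx ⊢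
        rw [inv_pow, hx] }
  have hK : ∀ x, x ∈ K ↔ x ^ p ^ J = x := fun x ↦ Iff.rfl
  refine ⟨K, ?_⟩
  have h1 : Nat.card Kˣ = p ^ J - 1 := by
    have h2 : Nat.card (powMonoidHom (p ^ J - 1) : Fˣ →* Fˣ).ker = p ^ J - 1 := by
      rw [IsCyclic.card_powMonoidHom_ker, Nat.card_eq_fintype_card, Fintype.card_units, hF]
      apply Nat.gcd_eq_right
      have := Nat.sub_dvd_pow_sub_pow (p ^ J) 1 2
      rwa [one_pow] at this
    rw [← h2]
    have h3 : ∀ x : Fˣ, x ∈ (powMonoidHom (p ^ J - 1) : Fˣ →* Fˣ).ker ↔ (x : F) ∈ K := by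
      intro x
      rw [MonoidHom.mem_ker, powMonoidHom_apply, hK]
      have : (x : F) ^ p ^ J = (x : F) ^ (p ^ J - 1) * x := by
        rw [← pow_succ, Nat.sub_add_cancel hq.le]
      rw [this, Units.ext_iff, Units.val_pow_eq_pow_val, Units.val_one]
      constructor
      · intro h; rw [h, one_mul]
      · intro h; exact mul_right_cancel₀ x.ne_zero (by rw [h, one_mul])
    refine Nat.card_congr
      { toFun := fun x ↦ ⟨Units.map K.subtype.toMonoidHom x, (h3 _).2 x.1.2⟩
        invFun := fun x ↦ Units.mk0 ⟨((x : Fˣ) : F), (h3 _).1 x.2⟩ (by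
          intro h
          exact (x : Fˣ).ne_zero (congrArg Subtype.val h))
        left_inv := fun x ↦ by ext; rfl
        right_inv := fun x ↦ by ext; rfl }
  rw [Nat.card_eq_fintype_card, Fintype.card_units] at h1
  have := Fintype.card_pos (α := K)
  omega

theorem exists_twoValuedPeriods {p J e : ℕ} (hp : p.Prime) (hJ : J ≠ 0) (he : e ∣ p ^ J + 1)
    (a : ℕ) : ∀ (F : Type*) [Field F] [Fintype F], Fintype.card F = (p ^ (J * 2 ^ a)) ^ 2 →
      ∀ H : Subgroup Fˣ, H.index = e → ∃ (ψ : AddChar F ℂ) (n : ℤ) (k : Fˣ), ψ ≠ 1 ∧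
        n ^ 2 = Fintype.card F ∧ TwoValuedPeriods ψ H e n k := by
  induction a with
  | zero =>
    intro F _ _ hF H hH
    rw [pow_zero, mul_one] at hF
    obtain ⟨K, hK⟩ := exists_subfield_card_eq hp hF hJ
    have hψ : ∃ ψ : AddChar F ℂ, ψ ≠ 1 := by
      obtain ⟨ψ, hψ⟩ := (AddChar.exists_apply_ne_zero (a := (1 : F))).2 one_ne_zero
      exact ⟨ψ, fun h ↦ hψ (by rw [h]; rfl)⟩
    obtain ⟨ψ, hψ⟩ := hψ
    obtain ⟨k, hk⟩ := exists_twoValuedPeriods_of_index_dvd (K := K) (by rw [hF, hK]) hψ hH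
      (by rwa [hK])
    exact ⟨ψ, _, k, hψ, by rw [hF, hK]; push_cast; rfl, hk⟩
  | succ a ih =>
    intro F _ _ hF H hH
    obtain ⟨K, hK⟩ := exists_subfield_card_eq hp hF (by positivity)
    have hK' : Fintype.card K = (p ^ (J * 2 ^ a)) ^ 2 := by
      rw [hK, ← pow_mul, pow_succ, mul_assoc]
    -- The induction needs a subgroup of index `e` in `Kˣ`: the `e`-th powers qualify, as `e ∣ p ^ J
    -- + 1` divides `|K| - 1`.
    have hindex : (powMonoidHom e : Kˣ →* Kˣ).range.index = e := by
      rw [IsCyclic.index_powMonoidHom_range, Nat.card_eq_fintype_card, Fintype.card_units, hK']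
      apply Nat.gcd_eq_right
      refine he.trans ?_
      have h1 : p ^ J + 1 ∣ (p ^ J) ^ 2 - 1 := by
        rw [← one_pow 2, Nat.sq_sub_sq, one_pow]
        exact Dvd.intro _ rfl
      have h2 := Nat.sub_dvd_pow_sub_pow ((p ^ J) ^ 2) 1 (2 ^ a)
      rw [one_pow] at h2
      refine (h1.trans h2).trans (dvd_of_eq ?_)
      rw [← pow_mul, ← pow_mul, ← pow_mul]
      congr 2
      ring
    obtain ⟨ψ, n, k, hψ, hn, h⟩ := ih K hK' _ hindex
    obtain ⟨k', hk'⟩ := h.comp_trace (F := F) (by rw [hF, hK]) hψ hn hindex hH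
    refine ⟨_, _, k', ?_, ?_, hk'⟩
    · rw [AddChar.ne_one_iff] at hψ ⊢
      obtain ⟨x, hx⟩ := hψ
      obtain ⟨y, rfl⟩ := Algebra.trace_surjective K F x
      exact ⟨y, hx⟩
    · rw [hF, hK]; push_cast; ring

/-! ### Gauss sums of nonsingular quadratic forms -/

section GaussSums

variable {F : Type*} [Field F] [Fintype F]

theorem map_sum_addChar {ι : Type*} (s : Finset ι) (ψ : AddChar F ℂ) (f : ι → F) :
    ψ (∑ i ∈ s, f i) = ∏ i ∈ s, ψ (f i) := by
  induction s using Finset.induction_on with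
  | empty => simp
  | insert a s ha ih => rw [Finset.sum_insert ha, Finset.prod_insert ha, AddChar.map_add_eq_mul, ih]

theorem sum_pi_addChar {ι : Type*} [Fintype ι] [DecidableEq ι] {A : Type*} [Fintype A] (ψ : AddChar F ℂ)
    (f : ι → A → F) : ∑ x : ι → A, ψ (∑ i, f i (x i)) = ∏ i, ∑ y, ψ (f i y) := by
  rw [Finset.prod_univ_sum, Fintype.piFinset_univ]
  exact Finset.sum_congr rfl fun x _ ↦ by
    rw [← map_sum_addChar]

theorem sum_addChar_mul_sq (hF : ringChar F ≠ 2) {ψ : AddChar F ℂ} (hψ : ψ ≠ 1) (c : Fˣ) :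
    ∑ y : F, ψ (c * y ^ 2) = (quadraticChar F c : ℂ) *
      gaussSum ((quadraticChar F).ringHomComp (Int.castRingHom ℂ)) ψ := by
  have h1 : ∑ y : F, ψ (c * y ^ 2) = ∑ a : F, ((quadraticChar F a : ℂ) + 1) * ψ (c * a) := by
    rw [← Finset.sum_fiberwise Finset.univ (fun y : F ↦ y ^ 2)]
    refine Finset.sum_congr rfl fun a _ ↦ ?_
    have h2 := quadraticChar_card_sqrts hF a
    have h3 : ∑ y ∈ Finset.univ.filter (fun y : F ↦ y ^ 2 = a), ψ (c * y ^ 2) =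
        ∑ y ∈ Finset.univ.filter (fun y : F ↦ y ^ 2 = a), ψ (c * a) :=
      Finset.sum_congr rfl fun y hy ↦ by rw [(Finset.mem_filter.1 hy).2]
    rw [h3, Finset.sum_const, nsmul_eq_mul]
    congr 1
    have h4 : (({x : F | x ^ 2 = a}.toFinset.card : ℤ) : ℂ) = ((quadraticChar F a + 1 : ℤ) : ℂ) := by
      rw [h2]
    rw [Set.toFinset_ofPred] at h4
    exact_mod_cast h4
  have h5 := gaussSum_mulShift ((quadraticChar F).ringHomComp (Int.castRingHom ℂ)) ψ c
  have h6 : (quadraticChar F c : ℂ) ^ 2 = 1 := by exact_mod_cast quadraticChar_sq_one c.ne_zero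
  have h7 : ∑ a : F, ψ (c * a) = 0 := by
    have := sum_addChar_mul hψ (c : F)
    rw [if_neg c.ne_zero] at this
    rw [← this]
    exact Finset.sum_congr rfl fun a _ ↦ by rw [mul_comm]
  rw [h1, ← h5, ← mul_assoc]
  simp only [add_mul, Finset.sum_add_distrib, one_mul, h7, add_zero]
  simp only [MulChar.ringHomComp_apply, Int.coe_castRingHom, gaussSum, AddChar.mulShift_apply]
  rw [← sq, h6, one_mul]

variable {V : Type*} [AddCommGroup V] [Module F V] [Fintype V]

/-- Diagonalising `Q` gives a product of `2m` one-variable Gauss sums. The even number of factors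
removes the dependence on `a`, and `g² = q` because `-1` is a square. -/
theorem exists_sum_addChar_eq_of_ringChar_ne_two (hF : ringChar F ≠ 2) {ψ : AddChar F ℂ}
    (hψ : ψ ≠ 1) {n : ℤ} (hn : n ^ 2 = Fintype.card F) {m : ℕ} (hV : Module.finrank F V = 2 * m)
    {Q : QuadraticForm F V} (hQ : Q.radical = ⊥) :
    ∃ ε : ℤ, (ε = 1 ∨ ε = -1) ∧
      ∀ a : Fˣ, ∑ x, ψ (a * Q x) = ε * ((Fintype.card F : ℤ) ^ m : ℤ) := by
  have : Invertible (2 : F) := invertibleOfNonzero (Ring.two_ne_zero hF)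
  have hsep : (QuadraticMap.associated (R := F) Q).SeparatingLeft := by
    rw [LinearMap.separatingLeft_iff_ker_eq_bot]
    rw [← QuadraticMap.radical_eq_ker_associated, hQ]
  obtain ⟨w, ⟨f⟩⟩ := Q.equivalent_weightedSumSquares_units_of_nondegenerate' hsep
  set g := gaussSum ((quadraticChar F).ringHomComp (Int.castRingHom ℂ)) ψ with hg
  have hsum : ∀ a : Fˣ, ∑ x, ψ (a * Q x) = ∏ i, ((quadraticChar F (a * w i : Fˣ) : ℂ) * g) := by
    intro a
    have h1 : ∑ x, ψ (a * Q x) = ∑ y : Fin _ → F, ψ (∑ i, ((a * w i : Fˣ) : F) * y i ^ 2) := by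
      refine Fintype.sum_equiv f.toEquiv _ _ fun x ↦ ?_
      have h2 := f.map_app x
      rw [QuadraticMap.weightedSumSquares_apply] at h2
      rw [← h2, Finset.mul_sum]
      congr 1
      refine Finset.sum_congr rfl fun i _ ↦ ?_
      rw [Units.smul_def, smul_eq_mul, Units.val_mul, sq, mul_assoc]
      rfl
    rw [h1, sum_pi_addChar ψ fun i y ↦ ((a * w i : Fˣ) : F) * y ^ 2]
    exact Finset.prod_congr rfl fun i _ ↦ sum_addChar_mul_sq hF hψ _
  -- Here `q = n²` enters: a square is not 3 modulo 4.
  have hneg : quadraticChar F (-1) = 1 := by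
    rw [quadraticChar_one_iff_isSquare (by simp), FiniteField.isSquare_neg_one_iff]
    intro h
    have h1 : n ^ 2 % 4 = 3 := by omega
    have h2 : n % 4 = 0 ∨ n % 4 = 1 ∨ n % 4 = 2 ∨ n % 4 = 3 := by omega
    rcases h2 with h2 | h2 | h2 | h2 <;> simp [pow_two, Int.mul_emod, h2] at h1
  have hg2 : g ^ 2 = Fintype.card F := by
    rw [hg, gaussSum_sq]
    · simp [hneg]
    · rw [MulChar.ringHomComp_ne_one_iff (RingHom.injective_int _)]
      exact quadraticChar_ne_one hF
    · exact (quadraticChar_isQuadratic F).comp _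
    · exact AddChar.IsPrimitive.of_ne_one hψ
  refine ⟨∏ i, quadraticChar F (w i), ?_, fun a ↦ ?_⟩
  · have h1 : (∏ i, quadraticChar F (w i : F)) ^ 2 = 1 := by
      rw [← Finset.prod_pow]
      exact Finset.prod_eq_one fun i _ ↦ quadraticChar_sq_one (w i).ne_zero
    simpa using sq_eq_sq_iff_eq_or_eq_neg.1 (h1.trans (one_pow 2).symm)
  · have h6 : (quadraticChar F a : ℂ) ^ 2 = 1 := by exact_mod_cast quadraticChar_sq_one a.ne_zero
    rw [hsum]
    simp only [Units.val_mul, map_mul, Int.cast_mul, Finset.prod_mul_distrib, Finset.prod_const,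
      Finset.card_univ, Fintype.card_fin, hV, pow_mul, h6, hg2]
    push_cast
    ring

/-- In the Leibniz expansion `σ` and `σ⁻¹` contribute equal terms, which cancel in characteristic 2.
A self-inverse `σ` on an odd set has a fixed point, so its term contains a zero diagonal entry. -/
theorem Matrix.det_eq_zero_of_alternating_of_odd [CharP F 2] {ι : Type*} [Fintype ι]
    [DecidableEq ι]
    (hι : Odd (Fintype.card ι)) {M : Matrix ι ι F} (hs : ∀ i j, M i j = M j i)
    (ha : ∀ i, M i i = 0) : M.det = 0 := by
  rw [Matrix.det_apply']
  refine Finset.sum_involution (fun σ _ ↦ σ⁻¹) ?_ ?_ (fun _ _ ↦ Finset.mem_univ _)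
    (fun σ _ ↦ inv_inv σ)
  · intro σ _
    have h1 : ∏ i, M (σ⁻¹ i) i = ∏ i, M (σ i) i := by
      rw [← Equiv.prod_comp σ]
      refine Finset.prod_congr rfl fun i _ ↦ ?_
      rw [hs]; simp
    rw [h1, Equiv.Perm.sign_inv]
    exact CharTwo.add_self_eq_zero _
  · intro σ _ h0 hσ
    apply h0
    have : Fact (Nat.Prime 2) := ⟨Nat.prime_two⟩
    obtain ⟨i, hi⟩ := Equiv.Perm.exists_fixed_point_of_prime (p := 2) (n := 1)
      (by rw [← even_iff_two_dvd]; exact Nat.not_even_iff_odd.2 hι) (σ := σ) (by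
        rw [pow_one, sq]
        nth_rewrite 1 [← hσ]
        exact inv_mul_cancel σ)
    rw [Finset.prod_eq_zero (Finset.mem_univ i), mul_zero]
    rw [hi, ha]

theorem exists_ne_zero_of_alternating_of_odd [CharP F 2] {W : Type*} [AddCommGroup W] [Module F W]
    [FiniteDimensional F W] (hW : Odd (Module.finrank F W)) (B : W →ₗ[F] W →ₗ[F] F)
    (hs : ∀ x y, B x y = B y x) (ha : ∀ x, B x x = 0) : ∃ w ≠ 0, ∀ y, B y w = 0 := by
  have v := Module.finBasis F W
  have hdet : (Matrix.of fun i j ↦ B (v i) (v j)).det = 0 :=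
    Matrix.det_eq_zero_of_alternating_of_odd (by simpa using hW) (fun _ _ ↦ hs _ _) fun _ ↦ ha _
  obtain ⟨c, hc, h⟩ := Matrix.exists_mulVec_eq_zero_iff.2 hdet
  refine ⟨∑ i, c i • v i, ?_, ?_⟩
  · intro h0
    apply hc
    funext i
    have hv := v.linearIndependent
    rw [Fintype.linearIndependent_iff] at hv
    exact hv c h0 i
  · have : B.flip (∑ i, c i • v i) = 0 := by
      refine v.ext fun j ↦ ?_
      have := congrFun h j
      simpa [Matrix.mulVec, dotProduct, mul_comm] using this
    intro y
    exact LinearMap.congr_fun this y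

theorem polar_nondegenerate_of_char_two [CharP F 2] {m : ℕ} (hV : Module.finrank F V = 2 * m)
    {Q : QuadraticForm F V} (hQ : Q.radical = ⊥) (b : V)
    (hb : ∀ x, QuadraticMap.polar Q b x = 0) : b = 0 := by
  by_contra hb0
  have hrad : ∀ x, Q x = 0 → (∀ y, QuadraticMap.polar Q x y = 0) → x = 0 := by
    intro x h1 h2
    have : x ∈ Q.radical := by
      rw [QuadraticMap.mem_radical_iff']
      refine ⟨h1, fun y ↦ ?_⟩
      have := h2 y
      rw [QuadraticMap.polar, h1] at this
      linear_combination this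
    rwa [hQ, Submodule.mem_bot] at this
  have hQb : Q b ≠ 0 := fun h ↦ hb0 (hrad b h hb)
  obtain ⟨f, hf⟩ : ∃ f : Module.Dual F V, f b ≠ 0 := by
    by_contra! h
    exact hb0 ((Module.forall_dual_apply_eq_zero_iff F b).1 h)
  -- Adding a coordinate paired with `f` makes the dimension odd, so this alternating form has a
  -- nonzero radical vector `(x, s)`. Pairing with `(b, 0)` and `(0, 1)` forces `s = 0` and `f x =
  -- 0`: thus `x` is a second vector in the polar radical, independent of `b`.
  let B : (V × F) →ₗ[F] (V × F) →ₗ[F] F :=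
    LinearMap.mk₂ F (fun x y ↦ QuadraticMap.polar Q x.1 y.1 + x.2 * f y.1 + y.2 * f x.1)
      (fun x x' y ↦ by simp [QuadraticMap.polar_add_left]; ring)
      (fun c x y ↦ by simp [QuadraticMap.polar_smul_left]; ring)
      (fun x y y' ↦ by simp [QuadraticMap.polar_add_right]; ring)
      (fun c x y ↦ by simp [QuadraticMap.polar_smul_right]; ring)
  obtain ⟨⟨x, s⟩, hw0, hw⟩ := exists_ne_zero_of_alternating_of_odd (F := F) (W := V × F)
    (by rw [Module.finrank_prod, hV, Module.finrank_self]; exact ⟨m, rfl⟩) B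
    (fun x y ↦ by simp only [B, LinearMap.mk₂_apply, QuadraticMap.polar_comm Q x.1]; ring)
    (fun x ↦ by
      simp only [B, LinearMap.mk₂_apply, QuadraticMap.polar_self, two_smul]
      rw [CharTwo.add_self_eq_zero, zero_add, CharTwo.add_self_eq_zero])
  simp only [B, LinearMap.mk₂_apply] at hw
  have hs : s = 0 := by
    have := hw (b, 0)
    simpa [hb, hf] using this
  subst hs
  have hfx : f x = 0 := by simpa using hw (0, 1)
  have hx : ∀ y, QuadraticMap.polar Q y x = 0 := fun y ↦ by simpa using hw (y, 0)
  -- With `l² = Q x / Q b`, the vector `x + l • b` is singular and in the polar radical, hence zero;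
  -- applying `f` gives `l = 0`.
  obtain ⟨l, hl⟩ := FiniteField.isSquare_of_char_two (F := F)
    ((ringChar.eq_iff (p := 2)).2 inferInstance) (Q x / Q b)
  have hxl : x + l • b = 0 := by
    apply hrad
    · have h1 := hb x
      rw [QuadraticMap.polar_comm] at h1
      have h2 := QuadraticMap.polar_smul_right Q l x b
      rw [h1, smul_zero, QuadraticMap.polar, sub_sub, sub_eq_zero] at h2
      rw [h2, QuadraticMap.map_smul, smul_eq_mul, ← hl, div_mul_cancel₀ _ hQb]
      exact CharTwo.add_self_eq_zero _
    · intro y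
      rw [QuadraticMap.polar_add_left, QuadraticMap.polar_smul_left, hb,
        QuadraticMap.polar_comm, hx, smul_zero, add_zero]
  have hl0 : l = 0 := by
    have := congrArg f hxl
    simpa [hfx, hf] using this
  apply hw0
  rw [hl0, zero_smul, add_zero] at hxl
  rw [hxl]
  rfl

theorem sum_addChar_mul_sum_addChar_neg {ψ : AddChar F ℂ} (hψ : ψ ≠ 1) (Q : QuadraticForm F V)
    (a : Fˣ) : (∑ x, ψ (a * Q x)) * ∑ x, ψ (-(a * Q x)) = Fintype.card V *
      ∑ y, if QuadraticMap.polarBilin Q y = 0 then ψ (a * Q y) else 0 := by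
  have h1 : ∀ y, ∑ x, ψ (a * Q (y + x)) * ψ (-(a * Q x)) =
      Fintype.card V * if QuadraticMap.polarBilin Q y = 0 then ψ (a * Q y) else 0 := by
    intro y
    have h2 := sum_addChar_bilin hψ ((a : F) • QuadraticMap.polarBilin Q y)
    have h3 : ∀ x, ψ (a * Q (y + x)) * ψ (-(a * Q x)) =
        ψ (a * Q y) * ψ (((a : F) • QuadraticMap.polarBilin Q y) x) := by
      intro x
      rw [← AddChar.map_add_eq_mul, ← AddChar.map_add_eq_mul]
      congr 1
      simp [QuadraticMap.polar]
      ring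
    rw [Finset.sum_congr rfl fun x _ ↦ h3 x, ← Finset.mul_sum, h2]
    simp only [smul_eq_zero, a.ne_zero, false_or]
    split_ifs <;> ring
  rw [Finset.mul_sum (s := Finset.univ) (a := (Fintype.card V : ℂ)),
    Finset.sum_congr rfl fun y _ ↦ (h1 y).symm, Finset.sum_comm, Finset.mul_sum]
  refine Finset.sum_congr rfl fun x _ ↦ ?_
  rw [← Finset.sum_mul]
  congr 1
  exact (Equiv.sum_comp (Equiv.addRight x) fun y ↦ ψ (a * Q y)).symm

/-- Every `a` is a square `l²`, absorbed by scaling `x` by `l`. Since `-1 = 1`, the product formula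
computes the square of the sum. -/
theorem exists_sum_addChar_eq_of_char_two [CharP F 2] {ψ : AddChar F ℂ} (hψ : ψ ≠ 1) {m : ℕ}
    (hV : Module.finrank F V = 2 * m) {Q : QuadraticForm F V} (hQ : Q.radical = ⊥) :
    ∃ ε : ℤ, (ε = 1 ∨ ε = -1) ∧
      ∀ a : Fˣ, ∑ x, ψ (a * Q x) = ε * ((Fintype.card F : ℤ) ^ m : ℤ) := by
  have hB := polar_nondegenerate_of_char_two hV hQ
  have h1 : (∑ x, ψ (Q x)) ^ 2 = ((Fintype.card F : ℂ) ^ m) ^ 2 := by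
    have h2 := sum_addChar_mul_sum_addChar_neg hψ Q 1
    have h3 : ∀ y, QuadraticMap.polarBilin Q y = 0 ↔ y = 0 := by
      intro y
      refine ⟨fun h ↦ hB y fun x ↦ ?_, fun h ↦ by simp [h]⟩
      rw [← QuadraticMap.polarBilin_apply_apply, h]; rfl
    simp only [Units.val_one, one_mul, CharTwo.neg_eq, h3] at h2
    rw [sq, h2, Module.card_eq_pow_finrank (K := F) (V := V), hV]
    simp [pow_mul']
  have h4 : ∀ a : Fˣ, ∑ x, ψ (a * Q x) = ∑ x, ψ (Q x) := by
    intro a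
    obtain ⟨l, hl⟩ := FiniteField.isSquare_of_char_two (F := F)
      ((ringChar.eq_iff (p := 2)).2 inferInstance) (a : F)
    have hl0 : l ≠ 0 := by
      rintro rfl
      rw [mul_zero] at hl
      exact a.ne_zero hl
    rw [← Equiv.sum_comp (LinearEquiv.smulOfNeZero F V l hl0).toEquiv fun x ↦ ψ (Q x)]
    refine Finset.sum_congr rfl fun x _ ↦ ?_
    simp [QuadraticMap.map_smul, hl]
  rcases sq_eq_sq_iff_eq_or_eq_neg.1 h1 with h | h
  · refine ⟨1, Or.inl rfl, fun a ↦ ?_⟩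
    rw [h4, h]
    push_cast
    ring
  · refine ⟨-1, Or.inr rfl, fun a ↦ ?_⟩
    rw [h4, h]
    push_cast
    ring

theorem exists_sum_addChar_eq {ψ : AddChar F ℂ} (hψ : ψ ≠ 1) {n : ℤ}
    (hn : n ^ 2 = Fintype.card F) {m : ℕ} (hV : Module.finrank F V = 2 * m)
    {Q : QuadraticForm F V} (hQ : Q.radical = ⊥) :
    ∃ ε : ℤ, (ε = 1 ∨ ε = -1) ∧
      ∀ a : Fˣ, ∑ x, ψ (a * Q x) = ε * ((Fintype.card F : ℤ) ^ m : ℤ) := by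
  by_cases hF : ringChar F = 2
  · have : CharP F 2 := (ringChar.eq_iff (p := 2)).1 hF
    exact exists_sum_addChar_eq_of_char_two hψ hV hQ
  · exact exists_sum_addChar_eq_of_ringChar_ne_two hF hψ hn hV hQ

/-- Translating by a polar radical vector `y` multiplies the nonzero Gauss sum by `ψ (a Q y)`, which
is therefore 1. The product formula then reads `E² = |V|` times the size of the radical. -/
theorem polar_nondegenerate_of_sum_addChar_eq {ψ : AddChar F ℂ} (hψ : ψ ≠ 1) {E : ℂ}
    (hE : E ^ 2 = Fintype.card V) {Q : QuadraticForm F V} (hG : ∀ a : Fˣ, ∑ x, ψ (a * Q x) = E)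
    (b : V) (hb : ∀ x, QuadraticMap.polar Q b x = 0) : b = 0 := by
  have hcard : (Fintype.card V : ℂ) ≠ 0 := by simp
  have hE0 : E ≠ 0 := by
    rintro rfl
    exact hcard (by rw [← hE]; simp)
  have hker : ∀ y, QuadraticMap.polarBilin Q y = 0 → ∀ a : Fˣ, ψ (a * Q y) = 1 := by
    intro y hy a
    apply mul_right_cancel₀ hE0
    rw [one_mul]
    nth_rewrite 1 [← hG a]
    rw [Finset.mul_sum, ← hG a, ← Equiv.sum_comp (Equiv.addLeft y) fun x ↦ ψ (a * Q x)]
    refine Finset.sum_congr rfl fun x _ ↦ ?_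
    rw [← AddChar.map_add_eq_mul]
    congr 1
    have : QuadraticMap.polar Q y x = 0 := by
      rw [← QuadraticMap.polarBilin_apply_apply, hy]; rfl
    rw [QuadraticMap.polar] at this
    simp only [Equiv.coe_addLeft]
    linear_combination -(a : F) * this
  have h1 := sum_addChar_mul_sum_addChar_neg hψ Q 1
  have h2 : ∑ x, ψ (-(((1 : Fˣ) : F) * Q x)) = E := by
    rw [← hG (-1)]
    simp
  have h3 : ∀ y, (if QuadraticMap.polarBilin Q y = 0 then ψ (((1 : Fˣ) : F) * Q y) else 0) =
      if QuadraticMap.polarBilin Q y = 0 then 1 else 0 := by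
    intro y
    split_ifs with hy
    · exact hker y hy 1
    · rfl
  rw [hG, h2, ← sq, hE, Finset.sum_congr rfl fun y _ ↦ h3 y, Finset.sum_boole] at h1
  have h4 : (Finset.univ.filter fun y ↦ QuadraticMap.polarBilin Q y = 0).card = 1 := by
    have := mul_left_cancel₀ hcard ((mul_one _).trans h1)
    exact_mod_cast this.symm
  refine Finset.card_le_one.1 h4.le b ?_ 0 ?_
  · simp only [Finset.mem_filter, Finset.mem_univ, true_and]
    ext x
    simpa using hb x
  · simp

end GaussSums

/-! ### Hyperbolic and elliptic forms -/

/-- Grouping the coordinates of a vector of even length into consecutive pairs. -/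
def pairCoordinates (F : Type*) (m : ℕ) : (Fin (2 * m) → F) ≃ (Fin m → F × F) where
  toFun x i := (x ⟨2 * i, by omega⟩, x ⟨2 * i + 1, by omega⟩)
  invFun y j := if (j : ℕ) % 2 = 0 then (y ⟨j / 2, by omega⟩).1 else (y ⟨j / 2, by omega⟩).2
  left_inv x := by
    funext j
    dsimp only
    split_ifs with h <;> congr 1 <;> ext <;> dsimp only <;> omega
  right_inv y := by
    funext i
    have h1 : (2 * (i : ℕ) + 1) / 2 = i := by omega
    have h2 : ¬ (2 * (i : ℕ) + 1) % 2 = 0 := by omega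
    simp [h1]

section BlockForms

variable {F : Type*} [Field F] [Fintype F]

theorem sum_addChar_blocks {m : ℕ} (ψ : AddChar F ℂ) (f : Fin m → F → F → F) :
    ∑ x : Fin (2 * m) → F, ψ (∑ i : Fin m, f i (x ⟨2 * i, by omega⟩) (x ⟨2 * i + 1, by omega⟩)) =
      ∏ i, ∑ y : F × F, ψ (f i y.1 y.2) := by
  rw [← sum_pi_addChar ψ fun i (y : F × F) ↦ f i y.1 y.2]
  exact Fintype.sum_equiv (pairCoordinates F m) _ _ fun x ↦ rfl

/-- The orthogonal sum of the binary forms `α i * y ^ 2 + β i * (y * z) + γ i * z ^ 2`. -/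
def blockForm {m : ℕ} (α β γ : Fin m → F) : QuadraticForm F (Fin (2 * m) → F) :=
  ∑ i : Fin m,
    (α i • QuadraticMap.linMulLin (LinearMap.proj (⟨2 * i, by omega⟩ : Fin (2 * m)))
        (LinearMap.proj (⟨2 * i, by omega⟩ : Fin (2 * m))) +
      β i • QuadraticMap.linMulLin (LinearMap.proj (⟨2 * i, by omega⟩ : Fin (2 * m)))
        (LinearMap.proj (⟨2 * i + 1, by omega⟩ : Fin (2 * m))) +
      γ i • QuadraticMap.linMulLin (LinearMap.proj (⟨2 * i + 1, by omega⟩ : Fin (2 * m)))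
        (LinearMap.proj (⟨2 * i + 1, by omega⟩ : Fin (2 * m))))

theorem blockForm_apply {m : ℕ} (α β γ : Fin m → F) (x : Fin (2 * m) → F) :
    blockForm α β γ x = ∑ i : Fin m, (α i * x ⟨2 * i, by omega⟩ ^ 2 +
      β i * (x ⟨2 * i, by omega⟩ * x ⟨2 * i + 1, by omega⟩) +
        γ i * x ⟨2 * i + 1, by omega⟩ ^ 2) := by
  simp [blockForm, sq]

theorem sum_addChar_mul_mul {ψ : AddChar F ℂ} (hψ : ψ ≠ 1) (a : Fˣ) :
    ∑ y : F × F, ψ (a * (y.1 * y.2)) = Fintype.card F := by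
  rw [Fintype.sum_prod_type]
  have h1 : ∀ x : F, ∑ y : F, ψ (a * (x * y)) = if x = 0 then (Fintype.card F : ℂ) else 0 := by
    intro x
    have := sum_addChar_mul hψ (a * x)
    simp only [mul_eq_zero, a.ne_zero, false_or] at this
    rw [← this]
    exact Finset.sum_congr rfl fun y _ ↦ by congr 1; ring
  simp [h1]

/-- The value is `εq` with `ε` independent of `t`. Summing over all `t : F` counts the single zero
of the form, giving `q² + (q - 1)εq = q`, so `ε = -1`. -/
theorem sum_addChar_anisotropic {ψ : AddChar F ℂ} (hψ : ψ ≠ 1) {n : ℤ}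
    (hn : n ^ 2 = Fintype.card F) {a b c : F}
    (h : ∀ y z : F, a * y ^ 2 + b * (y * z) + c * z ^ 2 = 0 → y = 0 ∧ z = 0) (t : Fˣ) :
    ∑ y : F × F, ψ (t * (a * y.1 ^ 2 + b * (y.1 * y.2) + c * y.2 ^ 2)) = -Fintype.card F := by
  have happ : ∀ x : Fin (2 * 1) → F, blockForm (m := 1) (fun _ ↦ a) (fun _ ↦ b) (fun _ ↦ c) x =
      a * x 0 ^ 2 + b * (x 0 * x 1) + c * x 1 ^ 2 := by
    intro x
    rw [blockForm_apply, Fin.sum_univ_one]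
    rfl
  have hrad : (blockForm (m := 1) (fun _ ↦ a) (fun _ ↦ b) (fun _ ↦ c)).radical = ⊥ := by
    rw [eq_bot_iff]
    intro x hx
    have h0 := (QuadraticMap.mem_radical_iff'.1 hx).1
    rw [happ] at h0
    obtain ⟨h1, h2⟩ := h _ _ h0
    rw [Submodule.mem_bot]
    funext i
    fin_cases i
    · exact h1
    · exact h2
  obtain ⟨ε, hε, hG⟩ := exists_sum_addChar_eq hψ hn (m := 1) (by simp) hrad
  have hsum : ∀ t : Fˣ, ∑ y : F × F, ψ (t * (a * y.1 ^ 2 + b * (y.1 * y.2) + c * y.2 ^ 2)) =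
      ε * Fintype.card F := by
    intro t
    have h1 := hG t
    have h2 := sum_addChar_blocks (m := 1) ψ
      fun _ y z ↦ (t : F) * (a * y ^ 2 + b * (y * z) + c * z ^ 2)
    rw [Fin.prod_univ_one] at h2
    rw [← h2]
    rw [pow_one] at h1
    push_cast at h1
    rw [← h1]
    refine Finset.sum_congr rfl fun x _ ↦ ?_
    rw [happ, Fin.sum_univ_one]
    rfl
  have htot : ∑ t : F, ∑ y : F × F, ψ (t * (a * y.1 ^ 2 + b * (y.1 * y.2) + c * y.2 ^ 2)) =
      Fintype.card F := by
    rw [Finset.sum_comm, Finset.sum_congr rfl fun y _ ↦ sum_addChar_mul hψ _,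
      Finset.sum_eq_single (0 : F × F)]
    · simp
    · intro y _ hy
      rw [if_neg]
      intro h0
      obtain ⟨h1, h2⟩ := h _ _ h0
      exact hy (Prod.ext h1 h2)
    · simp
  rw [sum_eq_zero_add_sum_units, Finset.sum_congr rfl fun t _ ↦ hsum t] at htot
  simp only [zero_mul, AddChar.map_zero_eq_one, Finset.sum_const, Finset.card_univ, nsmul_eq_mul,
    mul_one, Fintype.card_units, Fintype.card_prod] at htot
  rw [Nat.cast_sub Fintype.card_pos] at htot
  have hq : (Fintype.card F : ℂ) ≠ 0 := by simp
  have hq1 : (Fintype.card F : ℂ) - 1 ≠ 0 := by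
    rw [sub_ne_zero]
    exact_mod_cast (Fintype.one_lt_card (α := F)).ne'
  rw [hsum]
  apply mul_left_cancel₀ hq1
  push_cast at htot
  linear_combination htot

theorem sum_addChar_hyperbolic {m : ℕ} {ψ : AddChar F ℂ} (hψ : ψ ≠ 1) (t : Fˣ) :
    ∑ x : Fin (2 * m) → F, ψ (t * ∑ i : Fin m, x ⟨2 * i, by omega⟩ * x ⟨2 * i + 1, by omega⟩) =
      (Fintype.card F : ℂ) ^ m := by
  simp only [Finset.mul_sum]
  rw [sum_addChar_blocks ψ fun _ y z ↦ (t : F) * (y * z)]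
  simp [sum_addChar_mul_mul hψ]

theorem sum_addChar_elliptic {m : ℕ} (hm : 1 ≤ m) {ψ : AddChar F ℂ} (hψ : ψ ≠ 1) {n : ℤ}
    (hn : n ^ 2 = Fintype.card F) {a b c : F}
    (h : ∀ y z : F, a * y ^ 2 + b * (y * z) + c * z ^ 2 = 0 → y = 0 ∧ z = 0) (t : Fˣ) :
    ∑ x : Fin (2 * m) → F, ψ (t * ∑ i : Fin m,
      (let y := x ⟨2 * i, by omega⟩
       let z := x ⟨2 * i + 1, by omega⟩
       if (i : ℕ) + 1 < m then y * z else a * y ^ 2 + b * (y * z) + c * z ^ 2)) =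
      -(Fintype.card F : ℂ) ^ m := by
  simp only [Finset.mul_sum]
  rw [sum_addChar_blocks ψ fun (i : Fin m) y z ↦ (t : F) *
    (if (i : ℕ) + 1 < m then y * z else a * y ^ 2 + b * (y * z) + c * z ^ 2)]
  obtain ⟨k, rfl⟩ := Nat.exists_eq_add_of_le' hm
  rw [Fin.prod_univ_castSucc]
  simp [sum_addChar_mul_mul hψ, sum_addChar_anisotropic hψ hn h, pow_succ (Fintype.card F : ℂ)]

open MvPolynomial in
-- A nontrivial zero splits off a linear factor; both factors vanish at the origin, so neither is a
-- unit.
theorem anisotropic_of_irreducible {a b c : F}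
    (h : Irreducible (C a * X 0 ^ 2 + C b * (X 0 * X 1) + C c * X 1 ^ 2 : MvPolynomial (Fin 2) F))
    (y z : F) (hyz : a * y ^ 2 + b * (y * z) + c * z ^ 2 = 0) : y = 0 ∧ z = 0 := by
  have hunit : ∀ P : MvPolynomial (Fin 2) F, eval (fun _ ↦ 0) P = 0 → ¬ IsUnit P := by
    intro P hP hu
    have := hu.map (eval fun _ ↦ (0 : F))
    rw [hP] at this
    exact not_isUnit_zero this
  by_cases hz : z = 0
  · refine ⟨?_, hz⟩
    subst hz
    by_contra hy
    have ha : a = 0 := by simpa [hy] using hyz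
    have hfac : (C a * X 0 ^ 2 + C b * (X 0 * X 1) + C c * X 1 ^ 2 : MvPolynomial (Fin 2) F) =
        X 1 * (C b * X 0 + C c * X 1) := by
      rw [ha, C_0]; ring
    rcases h.isUnit_or_isUnit hfac with hu | hu <;> exact hunit _ (by simp) hu
  · exfalso
    have hfac : (C a * X 0 ^ 2 + C b * (X 0 * X 1) + C c * X 1 ^ 2 : MvPolynomial (Fin 2) F) =
        (X 0 - C (y / z) * X 1) * (C a * X 0 + C (a * (y / z) + b) * X 1) := by
      have hc : c = -(y / z) * (a * (y / z) + b) := by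
        field_simp
        linear_combination hyz
      rw [hc]
      simp only [C_mul, C_neg, C_add]
      ring
    rcases h.isUnit_or_isUnit hfac with hu | hu <;> exact hunit _ (by simp) hu

theorem exists_anisotropic_binary :
    ∃ a b c : F, ∀ y z : F, a * y ^ 2 + b * (y * z) + c * z ^ 2 = 0 → y = 0 ∧ z = 0 := by
  -- The map identifies `0` and `-1`, so it misses some `d`; then `y² + yz - dz²` is anisotropic in
  -- every characteristic.
  have hns : ¬ Function.Surjective fun x : F ↦ x ^ 2 + x := by
    rw [← Finite.injective_iff_surjective]
    intro h
    have : (0 : F) = -1 := h (by ring)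
    simp at this
  rw [Function.Surjective] at hns
  push Not at hns
  obtain ⟨d, hd⟩ := hns
  refine ⟨1, 1, -d, fun y z h ↦ ?_⟩
  have hz : z = 0 := by
    by_contra hz
    apply hd (y / z)
    field_simp
    linear_combination h
  subst hz
  simpa using h

theorem exists_quadraticForm_sum_addChar_eq {m : ℕ} (hm : 1 ≤ m) {ψ : AddChar F ℂ} (hψ : ψ ≠ 1)
    {n : ℤ} (hn : n ^ 2 = Fintype.card F) {ε : ℤ} (hε : ε = 1 ∨ ε = -1) :
    ∃ Q : QuadraticForm F (Fin (2 * m) → F),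
      ∀ t : Fˣ, ∑ x, ψ (t * Q x) = ε * ((Fintype.card F : ℤ) ^ m : ℤ) := by
  rcases hε with rfl | rfl
  · refine ⟨blockForm (fun _ ↦ 0) (fun _ ↦ 1) (fun _ ↦ 0), fun t ↦ ?_⟩
    simp only [blockForm_apply, zero_mul, one_mul, zero_add, add_zero]
    rw [sum_addChar_hyperbolic hψ]
    simp
  · obtain ⟨a, b, c, h⟩ := exists_anisotropic_binary (F := F)
    refine ⟨blockForm (fun i ↦ if (i : ℕ) + 1 < m then 0 else a)
      (fun i ↦ if (i : ℕ) + 1 < m then 1 else b)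
      (fun i ↦ if (i : ℕ) + 1 < m then 0 else c), fun t ↦ ?_⟩
    have h1 := sum_addChar_elliptic hm hψ hn h t
    have h2 : ((-1 : ℤ) : ℂ) * ((Fintype.card F : ℤ) ^ m : ℤ) = -(Fintype.card F : ℂ) ^ m := by
      simp
    rw [h2, ← h1]
    refine Finset.sum_congr rfl fun x _ ↦ ?_
    rw [blockForm_apply]
    congr 2
    refine Finset.sum_congr rfl fun i _ ↦ ?_
    dsimp only
    split_ifs <;> ring

theorem sum_addChar_of_isHyperbolicForm {m : ℕ} {ψ : AddChar F ℂ} (hψ : ψ ≠ 1)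
    {Q : QuadraticForm F (Fin (2 * m) → F)} (hQ : IsHyperbolicForm Q) (t : Fˣ) :
    ∑ x, ψ (t * Q x) = (Fintype.card F : ℂ) ^ m := by
  obtain ⟨L, hL⟩ := hQ
  rw [← sum_addChar_hyperbolic hψ t, ← Equiv.sum_comp L.toEquiv]
  exact Finset.sum_congr rfl fun x _ ↦ by rw [← hL]; rfl

theorem sum_addChar_of_isEllipticForm {m : ℕ} (hm : 1 ≤ m) {ψ : AddChar F ℂ} (hψ : ψ ≠ 1)
    {n : ℤ} (hn : n ^ 2 = Fintype.card F) {Q : QuadraticForm F (Fin (2 * m) → F)}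
    (hQ : IsEllipticForm Q) (t : Fˣ) : ∑ x, ψ (t * Q x) = -(Fintype.card F : ℂ) ^ m := by
  obtain ⟨a, b, c, hirr, L, hL⟩ := hQ
  rw [← sum_addChar_elliptic hm hψ hn (anisotropic_of_irreducible hirr) t,
    ← Equiv.sum_comp L.toEquiv]
  exact Finset.sum_congr rfl fun x _ ↦ by rw [← hL]; rfl

theorem zpowers_pow_eq_range {γ : Fˣ} (hγ : ∀ u : Fˣ, u ∈ Subgroup.zpowers γ) (e : ℕ) :
    Subgroup.zpowers (γ ^ e) = (powMonoidHom e : Fˣ →* Fˣ).range := by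
  rw [MonoidHom.range_eq_map, ← (Subgroup.eq_top_iff' _).2 hγ, MonoidHom.map_zpowers,
    powMonoidHom_apply]

end BlockForms

end CharacterSums

/-! ### Arithmetic of `e` and `q`, and the conclusion -/

/-- Write `s = 2^a s'` with `s'` odd. The odd part preserves divisibility, `p^j + 1 ∣ p^(js') + 1`,
and `2^a` sets the height of the tower. -/
theorem exists_semiprimitive_decomposition {p e j s q : ℕ} (hj : 0 < j)
    (he : e ∣ p ^ j + 1) (hs : 1 ≤ s) (hq : q = p ^ (2 * j * s)) :
    ∃ J a : ℕ, J ≠ 0 ∧ e ∣ p ^ J + 1 ∧ q = (p ^ (J * 2 ^ a)) ^ 2 := by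
  obtain ⟨a, s', hs', rfl⟩ := Nat.exists_eq_two_pow_mul_odd (by omega : s ≠ 0)
  refine ⟨j * s', a, (Nat.mul_pos hj hs'.pos).ne', he.trans ?_, ?_⟩
  · have := Odd.nat_add_dvd_pow_add_pow (p ^ j) 1 hs'
    rwa [one_pow, ← pow_mul] at this
  · rw [hq, ← pow_mul]
    congr 1
    ring

theorem dvd_sub_one_of_dvd_pow_add_one {p e j s q : ℕ} (he : e ∣ p ^ j + 1)
    (hq : q = p ^ (2 * j * s)) : e ∣ q - 1 := by
  have h1 : p ^ j + 1 ∣ (p ^ j) ^ 2 - 1 := by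
    rw [← one_pow 2, Nat.sq_sub_sq, one_pow]
    exact Dvd.intro _ rfl
  have h2 := Nat.sub_dvd_pow_sub_pow ((p ^ j) ^ 2) 1 s
  rw [one_pow] at h2
  refine he.trans ((h1.trans h2).trans (dvd_of_eq ?_))
  rw [hq, ← pow_mul, ← pow_mul]
  congr 2
  ring

theorem mainTheorem10 (p e j s q m : ℕ) (hp : p.Prime) (he : 2 < e)
    (hj : IsLeast {t : ℕ | 0 < t ∧ e ∣ p ^ t + 1} j) (hs : 1 ≤ s)
    (hq : q = p ^ (2 * j * s)) (hm : 1 ≤ m)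
    (F : Type*) [Field F] [Fintype F] (hF : Fintype.card F = q) :
    ∃ r : ℕ, r * e = q ^ (m - 1) * (q - 1) ∧
      (∀ ε : ℤ, ε = 1 ∨ ε = -1 →
        ∃ D : Set (Fin (2 * m) → F), IsLatinTypeCayley D ε ((q : ℤ) ^ m) r) ∧
      (∀ Q : QuadraticForm F (Fin (2 * m) → F), Q.radical = ⊥ →
        ∃ ε : ℤ, (ε = 1 ∨ ε = -1) ∧
          (IsHyperbolicForm Q → ε = 1) ∧ (IsEllipticForm Q → ε = -1) ∧
          ∀ γ : Fˣ, (∀ u : Fˣ, u ∈ Subgroup.zpowers γ) → ∀ i : ℕ, i < e →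
            IsLatinTypeCayley {x | Q x ∈ cyclotomicClass γ e i} ε ((q : ℤ) ^ m) r) := by
  classical
  obtain ⟨⟨hj0, hej⟩, -⟩ := hj
  have hdvd : e ∣ q - 1 := dvd_sub_one_of_dvd_pow_add_one hej hq
  obtain ⟨J, a, hJ, heJ, hqJ⟩ := exists_semiprimitive_decomposition hj0 hej hs hq
  have hq1 : 1 < q := hF ▸ Fintype.one_lt_card
  have hindex : (powMonoidHom e : Fˣ →* Fˣ).range.index = e := by
    rw [IsCyclic.index_powMonoidHom_range, Nat.card_eq_fintype_card, Fintype.card_units, hF]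
    exact Nat.gcd_eq_right hdvd
  obtain ⟨ψ, n, k, hψ, hn, hper⟩ := exists_twoValuedPeriods hp hJ heJ a F (hF.trans hqJ) _ hindex
  obtain ⟨r, hr⟩ : ∃ r, r * e = q ^ (m - 1) * (q - 1) := by
    obtain ⟨r, hr⟩ := hdvd.mul_left (q ^ (m - 1))
    exact ⟨r, by rw [hr, mul_comm]⟩
  have hr1 : 1 ≤ r := by
    rw [Nat.one_le_iff_ne_zero]
    rintro rfl
    have : 0 < q ^ (m - 1) * (q - 1) := by
      apply Nat.mul_pos
      · positivity
      · omega
    omega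
  have hN : (2 : ℤ) ≤ (q : ℤ) ^ m := by
    have : 2 ≤ q ^ m := (Nat.succ_le_of_lt hq1).trans (Nat.le_self_pow (by omega) q)
    exact_mod_cast this
  have hV : ((q : ℤ) ^ m) ^ 2 = Fintype.card (Fin (2 * m) → F) := by
    simp [hF, pow_mul']
  have hrq : (r * e * Fintype.card F : ℤ) = (q : ℤ) ^ m * (Fintype.card F - 1) := by
    have h1 : (r * e : ℤ) = (q : ℤ) ^ (m - 1) * ((q : ℤ) - 1) := by
      have : ((r * e : ℕ) : ℤ) = ((q ^ (m - 1) * (q - 1) : ℕ) : ℤ) := by rw [hr]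
      rw [Nat.cast_mul, Nat.cast_mul, Nat.cast_sub hq1.le] at this
      exact_mod_cast this
    obtain ⟨l, rfl⟩ := Nat.exists_eq_add_of_le' hm
    rw [h1, hF, Nat.add_sub_cancel]
    ring
  have key : ∀ (Q : QuadraticForm F (Fin (2 * m) → F)) (ε : ℤ), ε = 1 ∨ ε = -1 →
      (∀ t : Fˣ, ∑ x, ψ (t * Q x) = ε * ((Fintype.card F : ℤ) ^ m : ℤ)) → ∀ c : Fˣ,
      IsLatinTypeCayley {x | InCoset (powMonoidHom e : Fˣ →* Fˣ).range c (Q x)} ε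
        ((q : ℤ) ^ m) r := by
    intro Q ε hε hG c
    rw [hF] at hG
    refine isLatinTypeCayley_of_twoValuedPeriods hψ hε hN
      (polar_nondegenerate_of_sum_addChar_eq hψ ?_ hG) hG hper hn
      (card_mul_card_subgroup_units _ hindex) (by omega) hV hr1 hrq c
    have h1 : (ε : ℂ) ^ 2 = 1 := by rcases hε with rfl | rfl <;> simp
    rw [mul_pow, h1, one_mul]
    exact_mod_cast hV
  refine ⟨r, hr, fun ε hε ↦ ?_, fun Q hQ ↦ ?_⟩
  · obtain ⟨Q, hG⟩ := exists_quadraticForm_sum_addChar_eq hm hψ hn hε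
    exact ⟨_, key Q ε hε hG 1⟩
  · obtain ⟨ε, hε, hG⟩ := exists_sum_addChar_eq hψ hn (m := m) (by simp) hQ
    have hq0 : (Fintype.card F : ℂ) ^ m ≠ 0 := by simp
    have hval := hG 1
    rw [Int.cast_pow, Int.cast_natCast] at hval
    refine ⟨ε, hε, fun hh ↦ ?_, fun hh ↦ ?_, fun γ hγ i _ ↦ ?_⟩
    · have h1 := sum_addChar_of_isHyperbolicForm hψ hh 1
      have h2 : (ε : ℂ) = 1 := by
        apply mul_right_cancel₀ hq0
        rw [one_mul, ← hval, h1]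
      exact_mod_cast h2
    · have h1 := sum_addChar_of_isEllipticForm hm hψ hn hh 1
      have h2 : (ε : ℂ) = -1 := by
        apply mul_right_cancel₀ hq0
        rw [neg_one_mul, ← hval, h1]
      exact_mod_cast h2
    · have h1 := key Q ε hε hG (γ ^ i)
      -- For every primitive `γ` the group `⟨γ^e⟩` is the same group of `e`-th powers, so one `ε`
      -- serves all `γ` and `i`.
      rw [← zpowers_pow_eq_range hγ e] at h1
      exact h1
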